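/- **Setting.** Let $\Bbbk$ be a field, $R=\Bbbk[x_1,\dots,x_n]$, $\succ$ the graded reverse lexicographic order with $x_1\succ\dots\succ x_n$, and $\mathrm{LM}(f)$ the leading monomial of $f\neq 0$ (leading monomials of sets are those of their nonzero elements). For a sequence $\Phi=(\phi_1,\dots,\phi_t)$ of homogeneous elements of $R$ (with $\deg 0:=0$), the Macaulay matrix $\mathscr M_d(\Phi)$ has as rows the products $\tau\phi_i$ with $\tau$ a monomial of degree $d-\deg\phi_i\ge 0$; such a row has signature $\tau e_i$, and its columns are the monomials in decreasing order. Signatures are ordered position over term: $\tau e_i>\sigma e_j$ if $i>j$, or $i=j$ and $\tau\succ\sigma$. A valid elementary row operation adds to a row a $\Bbbk$-multiple of a row of smaller signature (the changed row keeps its signature). A row echelon form of a matrix is a matrix obtained from it by a sequence of valid elementary row operations, in which different nonzero rows have different leading monomials. **Algorithm $\mathsf{SigGB}(\Phi,S,D)$**, with $S$ a set of leading monomials of known syzygies of $\Phi$. For $d=0,1,\dots,D$ and $k=1,\dots,t$, starting from $\mathscr M_{d,0}=\emptyset$ and $G_k=\emptyset$, a matrix $\mathscr M_{d,k}$ is built,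 where $\widetilde{\mathscr M}_{d,k}$ denotes the computed row echelon form of $\mathscr M_{d,k}$ and $d_k=\deg\phi_k$: * if $d<d_k$, then $\mathscr M_{d,k}=\mathscr M_{d,k-1}$; if $d=d_k$, then $\mathscr M_{d,k}$ is $\widetilde{\mathscr M}_{d,k-1}$ with the row $\phi_k$ of signature $e_k$ added; * if $d>d_k$, then $\mathscr M_{d,k}$ is $\widetilde{\mathscr M}_{d,k-1}$ to which one adds, for each row $f$ of $\mathscr M_{d-1,k}$ with signature of the form $\tau e_k$, and for each $j\ge\max\{j': x_{j'}\mid\tau\}$ (every $j$ if $\tau=1$) with $\tau x_je_k\notin\mathrm{Crit}$, the row $x_jf$ with signature $\tau x_je_k$. Here $\mathrm{Crit}$ consists of $S$, of the $\mathrm{LM}(f)e_k$ for the nonzero rows $f$ of $\mathscr M_{d-d_k,k-1}$, and of the $\tau x_je_k$ for all $j$ and all zero rows of $\widetilde{\mathscr M}_{d-1,k}$ with signature of the form $\tau e_k$. In either case the rows $f$ of $\widetilde{\mathscr M}_{d,k}$ with $f\notin\langle\mathrm{LM}(G_k)\rangle$ are then added to $G_k$. The output is $G_1,\dots,G_t$.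 **Algorithm $\mathsf{CritGB}(F,g,D)$.** Let $F=(f_1,\dots,f_p)$ be homogeneous polynomials and $g$ a homogeneous polynomial in $R$, let $J=\operatorname{jac}(g,F)\in R^{(p+1)\times n}$ be the Jacobian matrix of $(g,f_1,\dots,f_p)$, and let $D\geq 0$ be an integer. 1. Let $C$ be the sequence of the entries of the first $\max(n-p-1,0)$ columns of $J$, column by column, and let $G_1,G_2,\dots$ be the output of $\mathsf{SigGB}(C,\emptyset,D-\delta)$, where $\delta$ is the least degree of a nonzero $\partial f_i/\partial x_j$ ($\delta=0$ if there is none). 2. Let $H$ be the set of all $\mathrm{LM}(h)e_c$ with $1\le i\le (p+1)(n-p-1)$, $h\in G_i$, and $c$ a maximal minor of $J$ that only uses columns with index at least $\lceil i/(p+1)\rceil+1$; here $e_c$ is the basis vector belonging to the minor $c$ in the sequence of step 3. 3. Arrange $f_1,\dots,f_p$ and all the $(p+1)\times(p+1)$ minors of $J$ as one sequence $\Phi=(\phi_1,\dots,\phi_t)$, in any way in which the minors appear in increasing lexicographic order of their column indices. Run $\mathsf{SigGB}(\Phi,H,D)$ and return its last set $G=G_t$. **Claim.** Algorithm $\mathsf{CritGB}$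 is correct. That is, row echelon forms by valid elementary row operations always exist (for matrices whose rows have distinct signatures), and whichever procedure (a fixed function of the matrix) is used to compute them, for every $D$ the finite set $G$ returned by $\mathsf{CritGB}(F,g,D)$ is a $(D,\succ)$-Gröbner basis of the critical ideal $$I=\langle F\rangle+I_{p+1}(\operatorname{jac}(g,F)),$$ where $I_{p+1}$ denotes the ideal of $(p+1)\times(p+1)$ minors. This means: * there are row echelon forms $\widetilde{\mathscr M}_d(\Phi)$ of the Macaulay matrices $\mathscr M_d(\Phi)$, $d\le D$, such that every element of $G$ is a row of one of them, and every nonzero row of them has a leading monomial divisible by $\mathrm{LM}(h)$ for some $h\in G$, $h\ne 0$; * $G\subseteq I$, and $\langle\mathrm{LM}(G)\rangle$ is the ideal generated by the leading monomials of the nonzero homogeneous elements of $I$ of degree at most $D$. -/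

import Mathlib

open MvPolynomial

open scoped MonomialOrder

/-! ### The graded reverse lexicographic order, as a `MonomialOrder` -/

/-- The exponent vectors of `n` variables, to be ordered by grevlex. -/
def Grevlex (n : ℕ) : Type := Fin n →₀ ℕ

namespace Grevlex

noncomputable instance (n : ℕ) : AddCommMonoid (Grevlex n) :=
  inferInstanceAs (AddCommMonoid (Fin n →₀ ℕ))

/-- Comparing exponent vectors by grevlex means comparing these keys lexicographically: first the
total degree, then the exponents, from the last variable to the first, with reversed sign. -/
noncomputable def key {n : ℕ} (a : Fin n →₀ ℕ) : ℕ ×ₗ Lex ((Fin n)ᵒᵈ → ℕᵒᵈ) :=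
  toLex (a.degree, toLex fun i => OrderDual.toDual (a (OrderDual.ofDual i)))

theorem key_injective {n : ℕ} : Function.Injective (key (n := n)) := by
  intro a b h
  have h2 := congrArg (fun z => ofLex (ofLex z).2) h
  ext i
  exact congrFun h2 (OrderDual.toDual i)

noncomputable instance (n : ℕ) : LinearOrder (Grevlex n) :=
  LinearOrder.lift' (fun a : Grevlex n => key (n := n) a) key_injective

/-- The identity, from exponent vectors to exponent vectors ordered by grevlex. -/
noncomputable def of {n : ℕ} : (Fin n →₀ ℕ) ≃+ Grevlex n := AddEquiv.refl _

theorem of_lt_of {n : ℕ} {a b : Fin n →₀ ℕ} : of a < of b ↔ key a < key b := Iff.rfl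

/-- The usual description of grevlex: `x ^ a ≺ x ^ b` if and only if `x ^ a` has the smaller
degree, or the degrees agree and, at the last variable where `a` and `b` differ, `a` has the larger
exponent. -/
theorem lt_iff {n : ℕ} {a b : Fin n →₀ ℕ} :
    of a < of b ↔ a.degree < b.degree ∨
      (a.degree = b.degree ∧ ∃ i, (∀ j, i < j → a j = b j) ∧ b i < a i) := by
  rw [of_lt_of, key, key, Prod.Lex.toLex_lt_toLex]
  rfl

theorem le_of_degree {n : ℕ} {a b : Fin n →₀ ℕ} (h : of a ≤ of b) : a.degree ≤ b.degree := by
  by_contra! hlt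
  exact absurd h (not_le.2 (lt_iff.2 (Or.inl hlt)))

theorem add_le_add_of {n : ℕ} (a b c : Fin n →₀ ℕ) (h : of a ≤ of b) :
    of (a + c) ≤ of (b + c) := by
  rcases h.eq_or_lt with h | h
  · rw [of.injective h]
  · refine le_of_lt ?_
    rw [lt_iff] at h ⊢
    rcases h with h | ⟨h, i, hi, hlt⟩
    · left
      simpa using h
    · right
      refine ⟨by simp [h], i, fun j hj => ?_, ?_⟩
      · simp [hi j hj]
      · simpa using hlt

instance (n : ℕ) : IsOrderedAddMonoid (Grevlex n) where
  add_le_add_left a b h c := add_le_add_of a b c h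

instance (n : ℕ) : WellFoundedLT (Grevlex n) := by
  have hfin : ∀ d : ℕ, {a : Fin n →₀ ℕ | a.degree ≤ d}.Finite := fun d =>
    Finsupp.finite_of_degree_le d
  refine ⟨WellFounded.wellFounded_iff_has_min.2 fun s ⟨x, hx⟩ => ?_⟩
  have hs : (s ∩ {y : Grevlex n | y ≤ x}).Finite :=
    (hfin (Finsupp.degree (show Fin n →₀ ℕ from x))).subset fun y hy => le_of_degree hy.2
  obtain ⟨y, hy, hmin⟩ := Set.exists_min_image _ id hs ⟨x, hx, le_refl x⟩
  refine ⟨y, hy.1, fun z hz hzy => ?_⟩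
  exact absurd (hmin z ⟨hz, hzy.le.trans hy.2⟩) (not_le.2 hzy)

end Grevlex

/-- The graded reverse lexicographic order on the monomials in `x_1 ≻ x_2 ≻ … ≻ x_n`. -/
noncomputable def grevlex (n : ℕ) : MonomialOrder (Fin n) where
  syn := Grevlex n
  toSyn := Grevlex.of
  toSyn_monotone a b h := by
    rcases eq_or_ne a b with rfl | hne
    · exact le_refl _
    · refine le_of_lt (Grevlex.lt_iff.2 (Or.inl ?_))
      obtain ⟨c, rfl⟩ := exists_add_of_le h
      have hc : c ≠ 0 := by rintro rfl; simp at hne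
      have : c.degree ≠ 0 := fun h0 => hc ((Finsupp.degree_eq_zero_iff c).1 h0)
      rw [map_add]
      omega

section SignatureGroebner

variable {n : ℕ} {𝕜 : Type*} [Field 𝕜]

/-! ### Gröbner bases and Macaulay matrices -/

/-- The set of leading monomials (as monic monomials) of the nonzero elements of `S`. -/
noncomputable def leadingMonomials (S : Set (MvPolynomial (Fin n) 𝕜)) :
    Set (MvPolynomial (Fin n) 𝕜) :=
  {u | ∃ f ∈ S, f ≠ 0 ∧ u = monomial ((grevlex n).degree f) 1}

/-- A signature: `(i, a)` stands for the module monomial `x ^ a e_i` (indices start from `0`). -/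
abbrev Signature (n : ℕ) : Type := ℕ × (Fin n →₀ ℕ)

/-- The position-over-term order on signatures: first compare the indices, then the monomials. -/
def Signature.Lt (s s' : Signature n) : Prop :=
  s.1 < s'.1 ∨ (s.1 = s'.1 ∧ s.2 ≺[grevlex n] s'.2)

/-- A matrix of Macaulay type: a finite set of rows, each with its signature. A row is stored as
the polynomial whose coefficients are its entries; the columns are indexed by the monomials, in
decreasing order, so that the first nonzero entry of a row is at its leading monomial. -/
abbrev SigMatrix (n : ℕ) (𝕜 : Type*) [Field 𝕜] : Type _ :=
  Finset (Signature n × MvPolynomial (Fin n) 𝕜)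

namespace SigMatrix

/-- The set of the rows of a matrix, without signatures. -/
def rows (M : SigMatrix n 𝕜) : Set (MvPolynomial (Fin n) 𝕜) := {f | ∃ s, (s, f) ∈ M}

/-- Different rows have different signatures. -/
def DistinctSignatures (M : SigMatrix n 𝕜) : Prop :=
  ∀ r ∈ M, ∀ r' ∈ M, r.1 = r'.1 → r = r'

open Classical in
/-- `N` arises from `M` by one valid elementary row operation: a multiple of a row is added to a
row of larger signature (which keeps its signature). -/
def RowOp (M N : SigMatrix n 𝕜) : Prop :=
  ∃ r ∈ M, ∃ r' ∈ M, r'.1.Lt r.1 ∧ ∃ c : 𝕜,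
    N = insert (r.1, r.2 + C c * r'.2) (M.erase r)

/-- Row echelon form, up to the order of the rows: the nonzero rows have pairwise different leading
monomials. -/
def IsEchelon (M : SigMatrix n 𝕜) : Prop :=
  ∀ r ∈ M, ∀ r' ∈ M, r.2 ≠ 0 → r'.2 ≠ 0 →
    (grevlex n).degree r.2 = (grevlex n).degree r'.2 → r = r'

/-- `N` is a row echelon form of `M`, obtained by a sequence of valid elementary row operations. -/
def IsEchelonFormOf (N M : SigMatrix n 𝕜) : Prop :=
  Relation.ReflTransGen RowOp M N ∧ N.IsEchelon

end SigMatrix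

/-- `ech` is a procedure that computes row echelon forms by valid elementary row operations (such
forms are not unique). -/
def IsEchelonization (ech : SigMatrix n 𝕜 → SigMatrix n 𝕜) : Prop :=
  ∀ M : SigMatrix n 𝕜, M.DistinctSignatures → (ech M).IsEchelonFormOf M

open Classical in
/-- The Macaulay matrix in degree `d` of a sequence of homogeneous polynomials: its rows are the
products `x ^ a * f_i` of degree `d`, with signature `x ^ a e_i`. -/
noncomputable def macaulay {t : ℕ} (F : Fin t → MvPolynomial (Fin n) 𝕜) (d : ℕ) :
    SigMatrix n 𝕜 :=
  (Finset.univ.filter fun i => (F i).totalDegree ≤ d).biUnion fun i =>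
    (Finset.finsuppAntidiag Finset.univ (d - (F i).totalDegree)).image fun a =>
      (((i : ℕ), a), monomial a 1 * F i)

/-- `G` is a `(D, ≻)`-Gröbner basis obtained from the Macaulay matrices of the sequence `F` of
homogeneous polynomials: there are row echelon forms of the Macaulay matrices of `F` in the degrees
up to `D` such that `G` consists of rows of these, and such that only redundant rows are left out,
i.e. zero rows and rows whose leading monomial is a multiple of the leading monomial of an element
of `G`. -/
def IsMacaulayBasis {t : ℕ} (F : Fin t → MvPolynomial (Fin n) 𝕜) (D : ℕ)
    (G : Set (MvPolynomial (Fin n) 𝕜)) : Prop :=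
  ∃ T : ℕ → SigMatrix n 𝕜, (∀ d ≤ D, (T d).IsEchelonFormOf (macaulay F d)) ∧
    (∀ g ∈ G, ∃ d ≤ D, g ∈ (T d).rows) ∧
    ∀ d ≤ D, ∀ f ∈ (T d).rows, f ≠ 0 →
      ∃ g ∈ G, g ≠ 0 ∧ (grevlex n).degree g ≤ (grevlex n).degree f

/-- `G` is a Gröbner basis up to degree `D` of the homogeneous ideal `I`: it is contained in `I`,
and its leading monomials generate the same ideal as the leading monomials of the homogeneous
elements of `I` of degree at most `D`. -/
def IsTruncatedGroebnerBasis (I : Ideal (MvPolynomial (Fin n) 𝕜)) (D : ℕ)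
    (G : Set (MvPolynomial (Fin n) 𝕜)) : Prop :=
  G ⊆ I ∧ Ideal.span (leadingMonomials G) =
    Ideal.span (leadingMonomials {f | f ∈ I ∧ ∃ d ≤ D, f.IsHomogeneous d})

/-! ### The matrix-F5 algorithm -/

open Classical in
/-- The matrix `M_{d,k}` that the matrix-F5 algorithm builds in degree `d` from the first `k` terms
of the sequence `F`, when `S` is a set of leading monomials of known syzygies of `F`. -/
noncomputable def sigMatrix (ech : SigMatrix n 𝕜 → SigMatrix n 𝕜) {t : ℕ}
    (F : Fin t → MvPolynomial (Fin n) 𝕜) (S : Set (Signature n)) (d k : ℕ) : SigMatrix n 𝕜 :=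
  match k with
  | 0 => ∅
  | i + 1 =>
    if hi : i < t then
      let f := F ⟨i, hi⟩
      if hlt : d < f.totalDegree then sigMatrix ech F S d i
      else if hd : d = f.totalDegree then ech (sigMatrix ech F S d i) ∪ {((i, 0), f)}
      else
        let prev := sigMatrix ech F S (d - 1) (i + 1)
        let crit : Set (Signature n) :=
          S ∪
          {s | s.1 = i ∧ ∃ r ∈ (sigMatrix ech F S (d - f.totalDegree) i).rows,
            r ≠ 0 ∧ s.2 = (grevlex n).degree r} ∪
          {s | s.1 = i ∧ ∃ a j, ((i, a), 0) ∈ ech prev ∧ s.2 = a + Finsupp.single j 1}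
        let pairs : Finset ((Signature n × MvPolynomial (Fin n) 𝕜) × Fin n) :=
          ((prev.filter fun r => r.1.1 = i) ×ˢ Finset.univ).filter fun q =>
            (∀ j' ∈ q.1.1.2.support, j' ≤ q.2) ∧ (i, q.1.1.2 + Finsupp.single q.2 1) ∉ crit
        let new : SigMatrix n 𝕜 :=
          pairs.image fun q => ((i, q.1.1.2 + Finsupp.single q.2 1), X q.2 * q.1.2)
        ech (sigMatrix ech F S d i) ∪ new
    else ∅
termination_by (d, k)
decreasing_by
  all_goals first
    | exact Prod.Lex.right _ (Nat.lt_succ_self i)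
    | exact Prod.Lex.left _ _ (by omega)
    | exact Prod.Lex.right' _ (Nat.sub_le _ _) (Nat.lt_succ_self i)

open Classical in
/-- The set `G_k` after the degrees `0, …, m - 1` have been treated by the matrix-F5 algorithm. -/
noncomputable def sigBasis (ech : SigMatrix n 𝕜 → SigMatrix n 𝕜) {t : ℕ}
    (F : Fin t → MvPolynomial (Fin n) 𝕜) (S : Set (Signature n)) (k : ℕ) :
    ℕ → Finset (MvPolynomial (Fin n) 𝕜)
  | 0 => ∅
  | m + 1 =>
    let G := sigBasis ech F S k m
    G ∪ ((ech (sigMatrix ech F S m k)).image Prod.snd).filter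
      fun f => f ∉ Ideal.span (leadingMonomials (G : Set (MvPolynomial (Fin n) 𝕜)))

/-- The output `G_1, …, G_t` of the matrix-F5 algorithm with degree bound `D`, as a function of the
index; `G_k` is computed from the first `k` terms of `F`. Nothing happens in degrees below the
degrees of the terms of `F`, so the loop over the degrees is started at `0`; it is empty if `D` is
negative. -/
noncomputable def sigGB (ech : SigMatrix n 𝕜 → SigMatrix n 𝕜) {t : ℕ}
    (F : Fin t → MvPolynomial (Fin n) 𝕜) (S : Set (Signature n)) (D : ℤ) (k : ℕ) :
    Finset (MvPolynomial (Fin n) 𝕜) :=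
  sigBasis ech F S k (D + 1).toNat

/-! ### Critical points -/

/-- The ideal generated by the minors of size `r` of a matrix. -/
def minorsIdeal {R : Type*} [CommRing R] {p q : ℕ} (r : ℕ) (A : Matrix (Fin p) (Fin q) R) :
    Ideal R :=
  Ideal.span {h | ∃ (u : Fin r ↪o Fin p) (c : Fin r ↪o Fin q), h = (A.submatrix u c).det}

/-- The Jacobian matrix of `(g, f_1, …, f_p)`. -/
noncomputable def jac {p : ℕ} (g : MvPolynomial (Fin n) 𝕜) (F : Fin p → MvPolynomial (Fin n) 𝕜) :
    Matrix (Fin (p + 1)) (Fin n) (MvPolynomial (Fin n) 𝕜) :=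
  Matrix.of fun i j => pderiv j (Fin.cons (α := fun _ => MvPolynomial (Fin n) 𝕜) g F i)

/-- The ideal generated by `F` and by the maximal minors of the Jacobian matrix of `(g, F)`. -/
noncomputable def criticalIdeal {p : ℕ} (F : Fin p → MvPolynomial (Fin n) 𝕜)
    (g : MvPolynomial (Fin n) 𝕜) : Ideal (MvPolynomial (Fin n) 𝕜) :=
  Ideal.span (Set.range F) + minorsIdeal (p + 1) (jac g F)

/-- The maximal minor of the Jacobian matrix with columns `c 0 < ⋯ < c p`. -/
noncomputable def jacMinor {p : ℕ} (g : MvPolynomial (Fin n) 𝕜)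
    (F : Fin p → MvPolynomial (Fin n) 𝕜) (c : Fin (p + 1) ↪o Fin n) : MvPolynomial (Fin n) 𝕜 :=
  ((jac g F).submatrix id c).det

/-- The entries of the first `n - p - 1` columns of the Jacobian matrix, column by column. -/
noncomputable def jacColumns {p : ℕ} (g : MvPolynomial (Fin n) 𝕜)
    (F : Fin p → MvPolynomial (Fin n) 𝕜) (k : Fin ((n - p - 1) * (p + 1))) :
    MvPolynomial (Fin n) 𝕜 :=
  jac g F k.modNat (Fin.castLE (by omega) k.divNat)

/-- The system of `F` and the maximal minors, arranged as a sequence in the way given by `e`. -/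
noncomputable def critSystem {p t : ℕ} (F : Fin p → MvPolynomial (Fin n) 𝕜)
    (g : MvPolynomial (Fin n) 𝕜) (e : Fin t ≃ Fin p ⊕ (Fin (p + 1) ↪o Fin n)) (k : Fin t) :
    MvPolynomial (Fin n) 𝕜 :=
  Sum.elim F (jacMinor g F) (e k)

/-- The least degree of a nonzero partial derivative of one of the `f_i`. -/
noncomputable def minPartialDegree {p : ℕ} (F : Fin p → MvPolynomial (Fin n) 𝕜) : ℕ :=
  sInf {d | ∃ i j, pderiv j (F i) ≠ 0 ∧ d = (pderiv j (F i)).totalDegree}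

/-- The set `H` of the algorithm: the module monomials `x ^ a e_c`, where `x ^ a` is the leading
monomial of an element of the basis `G_i` for the first `i` entries of the Jacobian matrix (column
by column), and `c` is a maximal minor that only uses columns after the `⌈i / (p + 1)⌉` columns
from which these entries are taken. -/
noncomputable def critSyzygies (ech : SigMatrix n 𝕜 → SigMatrix n 𝕜) {p t : ℕ}
    (F : Fin p → MvPolynomial (Fin n) 𝕜) (g : MvPolynomial (Fin n) 𝕜)
    (e : Fin t ≃ Fin p ⊕ (Fin (p + 1) ↪o Fin n)) (D : ℕ) : Set (Signature n) :=
  {s | ∃ i ∈ Finset.Icc 1 ((n - p - 1) * (p + 1)), ∃ c : Fin (p + 1) ↪o Fin n,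
    (∀ j, i ⌈/⌉ (p + 1) ≤ (c j : ℕ)) ∧
    ∃ h ∈ sigGB ech (jacColumns g F) ∅ ((D : ℤ) - minPartialDegree F) i, h ≠ 0 ∧
      s = ((e.symm (Sum.inr c) : ℕ), (grevlex n).degree h)}

/-- Algorithm CritGB. The parameter `ech` is the procedure used for the computation of row echelon
forms, and `e` is the arrangement of the system `F ∪ {maximal minors}` as a sequence. -/
noncomputable def critGB (ech : SigMatrix n 𝕜 → SigMatrix n 𝕜) {p t : ℕ}
    (F : Fin p → MvPolynomial (Fin n) 𝕜) (g : MvPolynomial (Fin n) 𝕜)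
    (e : Fin t ≃ Fin p ⊕ (Fin (p + 1) ↪o Fin n)) (D : ℕ) : Finset (MvPolynomial (Fin n) 𝕜) :=
  sigGB ech (critSystem F g e) (critSyzygies ech F g e D) D t

end SignatureGroebner

/-! The heart of the matter is an invariant, `IsReducedMacaulay`: a matrix built by the algorithm is
the Macaulay matrix of the first `k` terms in degree `d`, except that rows may have changed by
combinations of rows of smaller signature, and that a row may be missing if it is itself such a
combination ("redundant"). Valid row operations preserve this. So does the passage from degree `d -
1` to `d`, because multiplication by a monomial respects the order on signatures: if the row of `τ
e_k` is redundant, so is that of `τ x_j e_k`. Finally, if `h φ_k` lies in the ideal of the earlier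
terms, solving for the leading term of `h` shows that `LM(h) e_k` is redundant. Hence every
signature rejected by `Crit` is redundant (`isReducedMacaulay_sigMatrix`).

Valid row operations can realise any change of the rows by combinations of rows of smaller signature
(`reflTransGen_of_sub_mem_spanLt`). Filling in zero rows for the missing signatures therefore gives
a genuine echelon form of the full Macaulay matrix (`IsReducedMacaulay.exists_isEchelonFormOf`). An
echelon form displays all leading monomials of its row space (`IsEchelon.exists_degree_eq`), and
this row space is the degree `d` part of the ideal.

This works for any set `S` of redundant signatures, so it remains to see that `H` is one. Let `a` be
an entry of the Jacobian matrix to the left of all columns of a minor `c`. Bordering the minor by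
the column of `a` and a second copy of its row gives a vanishing determinant, whose expansion writes
`a` times the minor through lexicographically smaller minors (`Matrix.mul_det_submatrix_mem_span`).
These precede `c` in the sequence. By linearity the same holds for the elements of `G_i`, which lie
in the ideal of the first `i` entries. -/

/-! ### Signatures -/

namespace Signature

variable {n : ℕ}

/-- Signatures as elements of a linear order. -/
noncomputable def key (s : Signature n) : ℕ ×ₗ Grevlex n := toLex (s.1, Grevlex.of s.2)

theorem lt_iff_key {s s' : Signature n} : s.Lt s' ↔ s.key < s'.key := by
  rw [key, key, Prod.Lex.toLex_lt_toLex]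
  rfl

theorem key_injective : Function.Injective (key (n := n)) := by
  intro a b h
  have h' : (a.1, Grevlex.of a.2) = (b.1, Grevlex.of b.2) := toLex.injective h
  rw [Prod.mk.injEq] at h'
  exact Prod.ext h'.1 (Grevlex.of.injective h'.2)

theorem Lt.trans {s s' s'' : Signature n} (h : s.Lt s') (h' : s'.Lt s'') : s.Lt s'' := by
  rw [lt_iff_key] at *
  exact _root_.lt_trans h h'

theorem Lt.ne {s s' : Signature n} (h : s.Lt s') : s ≠ s' := by
  rintro rfl
  exact lt_irrefl _ (lt_iff_key.1 h)

theorem Lt.add {i j : ℕ} {a b : Fin n →₀ ℕ} (h : Signature.Lt (i, a) (j, b)) (c : Fin n →₀ ℕ) :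
    Signature.Lt (i, a + c) (j, b + c) := by
  rcases h with h | ⟨h, h'⟩
  · exact Or.inl h
  · refine Or.inr ⟨h, ?_⟩
    simpa using h'

end Signature

/-! ### Leading monomials -/

section LeadingMonomial

variable {n : ℕ} {𝕜 : Type*} [Field 𝕜]

theorem grevlex_degree_smul {c : 𝕜} (hc : c ≠ 0) (f : MvPolynomial (Fin n) 𝕜) :
    (grevlex n).degree (c • f) = (grevlex n).degree f :=
  (grevlex n).degree_smul_of_isRegular (IsRegular.of_ne_zero hc)

/-- Two nonzero polynomials with the same leading monomial have a combination that cancels it. -/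
theorem exists_sub_smul_degree_lt {f g : MvPolynomial (Fin n) 𝕜} (hg : g ≠ 0)
    (h : (grevlex n).degree f = (grevlex n).degree g) :
    ∃ c : 𝕜, f - c • g = 0 ∨ (grevlex n).degree (f - c • g) ≺[grevlex n] (grevlex n).degree f := by
  have hg' := (grevlex n).leadingCoeff_ne_zero_iff.2 hg
  refine ⟨(grevlex n).leadingCoeff f / (grevlex n).leadingCoeff g, ?_⟩
  set c := (grevlex n).leadingCoeff f / (grevlex n).leadingCoeff g with hc
  by_cases h0 : f - c • g = 0
  · exact Or.inl h0
  right
  refine lt_of_le_of_ne ?_ fun heq => ?_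
  · refine ((grevlex n).degree_sub_le).trans (sup_le le_rfl ?_)
    rw [h]
    exact (grevlex n).degree_smul_le
  · have heq' := (grevlex n).toSyn.injective heq
    refine ((grevlex n).coeff_degree_ne_zero_iff.2 h0) ?_
    rw [heq', coeff_sub, coeff_smul, smul_eq_mul]
    nth_rewrite 2 [h]
    change (grevlex n).leadingCoeff f - c * (grevlex n).leadingCoeff g = 0
    rw [hc, div_mul_cancel₀ _ hg', sub_self]

end LeadingMonomial

/-! ### Row operations -/

namespace SigMatrix

variable {n : ℕ} {𝕜 : Type*} [Field 𝕜]

/-- Signatures of the rows of a matrix. -/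
def HasSignature (M : SigMatrix n 𝕜) (s : Signature n) : Prop := ∃ f, (s, f) ∈ M

theorem RowOp.distinctSignatures {M N : SigMatrix n 𝕜} (h : RowOp M N)
    (hM : M.DistinctSignatures) : N.DistinctSignatures := by
  classical
  obtain ⟨r, hr, r', -, -, c, rfl⟩ := h
  intro q hq q' hq' heq
  simp only [Finset.mem_insert, Finset.mem_erase] at hq hq'
  rcases hq with rfl | ⟨hne, hq⟩ <;> rcases hq' with rfl | ⟨hne', hq'⟩
  · rfl
  · exact absurd (hM _ hr _ hq' heq).symm hne'
  · exact absurd (hM _ hq _ hr heq) hne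
  · exact hM _ hq _ hq' heq

theorem RowOp.hasSignature_iff {M N : SigMatrix n 𝕜} (h : RowOp M N) (s : Signature n) :
    N.HasSignature s ↔ M.HasSignature s := by
  classical
  obtain ⟨r, hr, r', -, -, c, rfl⟩ := h
  simp only [HasSignature, Finset.mem_insert, Finset.mem_erase]
  constructor
  · rintro ⟨f, h | h⟩
    · obtain rfl : s = r.1 := (Prod.ext_iff.1 h).1
      exact ⟨r.2, hr⟩
    · exact ⟨f, h.2⟩
  · rintro ⟨f, h⟩
    by_cases heq : (s, f) = r
    · subst heq
      exact ⟨_, Or.inl rfl⟩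
    · exact ⟨f, Or.inr ⟨heq, h⟩⟩

/-- The general form of an invariant: it is enough that a property of signed rows survives adding a
multiple of a row of smaller signature. -/
theorem RowOp.forall_mem {M N : SigMatrix n 𝕜} (h : RowOp M N)
    {P : Signature n → MvPolynomial (Fin n) 𝕜 → Prop}
    (hP : ∀ s s' f f' (c : 𝕜), Signature.Lt s' s → P s f → P s' f' → P s (f + C c * f'))
    (hM : ∀ r ∈ M, P r.1 r.2) : ∀ r ∈ N, P r.1 r.2 := by
  classical
  obtain ⟨r, hr, r', hr', hlt, c, rfl⟩ := h
  intro q hq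
  simp only [Finset.mem_insert, Finset.mem_erase] at hq
  rcases hq with rfl | ⟨-, hq⟩
  · exact hP _ _ _ _ _ hlt (hM _ hr) (hM _ hr')
  · exact hM _ hq

theorem distinctSignatures_of_reflTransGen {M N : SigMatrix n 𝕜}
    (h : Relation.ReflTransGen RowOp M N) (hM : M.DistinctSignatures) :
    N.DistinctSignatures := by
  induction h with
  | refl => exact hM
  | tail _ h ih => exact h.distinctSignatures ih

theorem hasSignature_iff_of_reflTransGen {M N : SigMatrix n 𝕜}
    (h : Relation.ReflTransGen RowOp M N) (s : Signature n) :
    N.HasSignature s ↔ M.HasSignature s := by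
  induction h with
  | refl => rfl
  | tail _ h ih => exact (h.hasSignature_iff s).trans ih

theorem forall_mem_of_reflTransGen {M N : SigMatrix n 𝕜}
    (h : Relation.ReflTransGen RowOp M N)
    {P : Signature n → MvPolynomial (Fin n) 𝕜 → Prop}
    (hP : ∀ s s' f f' (c : 𝕜), Signature.Lt s' s → P s f → P s' f' → P s (f + C c * f'))
    (hM : ∀ r ∈ M, P r.1 r.2) : ∀ r ∈ N, P r.1 r.2 := by
  induction h with
  | refl => exact hM
  | tail _ h ih => exact h.forall_mem hP ih

/-- The span of the rows of smaller signature. -/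
noncomputable def spanLt (M : SigMatrix n 𝕜) (s : Signature n) : Submodule 𝕜 (MvPolynomial (Fin n) 𝕜) :=
  Submodule.span 𝕜 {f | ∃ s', Signature.Lt s' s ∧ (s', f) ∈ M}

theorem spanLt_mono {M N : SigMatrix n 𝕜} (hMN : M ⊆ N) {s s' : Signature n}
    (h : s = s' ∨ Signature.Lt s s') : M.spanLt s ≤ N.spanLt s' := by
  refine Submodule.span_mono ?_
  rintro f ⟨s'', hlt, hf⟩
  rcases h with rfl | h
  · exact ⟨s'', hlt, hMN hf⟩
  · exact ⟨s'', hlt.trans h, hMN hf⟩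

/-- Row operations change the rows by combinations of the original rows of smaller signature. -/
theorem exists_sub_mem_spanLt {M N : SigMatrix n 𝕜} (h : Relation.ReflTransGen RowOp M N) :
    ∀ r ∈ N, ∃ f, (r.1, f) ∈ M ∧ r.2 - f ∈ M.spanLt r.1 := by
  refine forall_mem_of_reflTransGen h
    (P := fun s f => ∃ f', (s, f') ∈ M ∧ f - f' ∈ M.spanLt s) ?_ ?_
  · rintro s s' f f' c hlt ⟨f₀, hf₀, hf⟩ ⟨f₀', hf₀', hf'⟩
    refine ⟨f₀, hf₀, ?_⟩
    have h1 : f' ∈ M.spanLt s := by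
      have := Submodule.add_mem _ (spanLt_mono subset_rfl (Or.inr hlt) hf')
        (Submodule.subset_span ⟨s', hlt, hf₀'⟩ : f₀' ∈ M.spanLt s)
      simpa using this
    have h2 := Submodule.add_mem _ hf (Submodule.smul_mem _ c h1)
    rw [smul_eq_C_mul] at h2
    convert h2 using 1
    ring
  · intro r hr
    exact ⟨r.2, hr, by simp⟩

open Classical in
/-- The matrix with the rows `f s`, for `s` in `A`. -/
noncomputable def ofFun (A : Finset (Signature n)) (f : Signature n → MvPolynomial (Fin n) 𝕜) :
    SigMatrix n 𝕜 :=
  A.image fun s => (s, f s)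

theorem mem_ofFun {A : Finset (Signature n)} {f : Signature n → MvPolynomial (Fin n) 𝕜}
    {r : Signature n × MvPolynomial (Fin n) 𝕜} :
    r ∈ ofFun A f ↔ r.1 ∈ A ∧ r.2 = f r.1 := by
  classical
  rw [ofFun, Finset.mem_image]
  constructor
  · rintro ⟨s, hs, rfl⟩
    exact ⟨hs, rfl⟩
  · rintro ⟨h, h'⟩
    exact ⟨r.1, h, Prod.ext rfl h'.symm⟩

theorem ofFun_congr {A : Finset (Signature n)} {f g : Signature n → MvPolynomial (Fin n) 𝕜}
    (h : ∀ s ∈ A, f s = g s) : ofFun A f = ofFun A g := by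
  ext r
  rw [mem_ofFun, mem_ofFun]
  exact and_congr_right fun hr => by rw [h _ hr]

/-- With rows given as a function of the signature, a row operation becomes a `Function.update`. -/
theorem DistinctSignatures.exists_eq_ofFun {M : SigMatrix n 𝕜} (hM : M.DistinctSignatures) :
    ∃ A f, M = ofFun A f := by
  classical
  refine ⟨M.image Prod.fst, fun s => if h : M.HasSignature s then h.choose else 0, ?_⟩
  ext r
  rw [mem_ofFun, Finset.mem_image]
  constructor
  · intro hr
    have h : M.HasSignature r.1 := ⟨r.2, hr⟩
    refine ⟨⟨r, hr, rfl⟩, ?_⟩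
    rw [dif_pos h]
    exact (Prod.ext_iff.1 (hM r hr (r.1, h.choose) h.choose_spec rfl)).2
  · rintro ⟨⟨q, hq, hqr⟩, h'⟩
    have h : M.HasSignature r.1 := ⟨q.2, by rw [← hqr]; exact hq⟩
    rw [dif_pos h] at h'
    have := h.choose_spec
    rwa [← h'] at this

theorem distinctSignatures_ofFun (A : Finset (Signature n))
    (f : Signature n → MvPolynomial (Fin n) 𝕜) : (ofFun A f).DistinctSignatures := by
  intro r hr r' hr' h
  rw [mem_ofFun] at hr hr'
  exact Prod.ext h (by rw [hr.2, hr'.2, h])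

open Classical in
theorem rowOp_update {A : Finset (Signature n)} {f : Signature n → MvPolynomial (Fin n) 𝕜}
    {s s' : Signature n} (hs : s ∈ A) (hs' : s' ∈ A) (hlt : Signature.Lt s' s) (c : 𝕜) :
    RowOp (ofFun A f) (ofFun A (Function.update f s (f s + c • f s'))) := by
  refine ⟨(s, f s), mem_ofFun.2 ⟨hs, rfl⟩, (s', f s'), mem_ofFun.2 ⟨hs', rfl⟩, hlt, c, ?_⟩
  ext ⟨q, u⟩
  simp only [mem_ofFun, Finset.mem_insert, Finset.mem_erase, ← smul_eq_C_mul, Prod.mk.injEq]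
  by_cases hq : q = s
  · subst hq
    simp only [Function.update_self]
    tauto
  · simp [hq]

open Classical in
theorem reflTransGen_update {A : Finset (Signature n)}
    {f : Signature n → MvPolynomial (Fin n) 𝕜} {s : Signature n} (hs : s ∈ A)
    {v : MvPolynomial (Fin n) 𝕜}
    (hv : v ∈ Submodule.span 𝕜 {u | ∃ s' ∈ A, Signature.Lt s' s ∧ u = f s'}) :
    Relation.ReflTransGen RowOp (ofFun A f) (ofFun A (Function.update f s (f s + v))) := by
  -- The current row `u` and the scalar `c` are kept arbitrary so that the induction over the span
  -- can chain two additions and absorb scalars.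
  have key : ∀ (c : 𝕜) (u : MvPolynomial (Fin n) 𝕜), Relation.ReflTransGen RowOp
      (ofFun A (Function.update f s u)) (ofFun A (Function.update f s (u + c • v))) := by
    induction hv using Submodule.span_induction with
    | mem x hx =>
      obtain ⟨s', hs', hlt, rfl⟩ := hx
      intro c u
      have := rowOp_update (f := Function.update f s u) hs hs' hlt c
      rw [Function.update_idem, Function.update_self, Function.update_of_ne hlt.ne] at this
      exact Relation.ReflTransGen.single this
    | zero =>
      intro c u
      rw [smul_zero, add_zero]
    | add x y _ _ hx hy =>
      intro c u
      rw [smul_add, ← add_assoc]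
      exact (hx c u).trans (hy c _)
    | smul a x _ hx =>
      intro c u
      rw [smul_smul]
      exact hx (c * a) u
  have := key 1 (f s)
  rwa [Function.update_eq_self, one_smul] at this

/-- A matrix whose rows differ from those of another one by combinations of rows of smaller
signature can be obtained from it by valid row operations. -/
theorem reflTransGen_ofFun {A : Finset (Signature n)}
    {f g : Signature n → MvPolynomial (Fin n) 𝕜}
    (h : ∀ s ∈ A, g s - f s ∈ Submodule.span 𝕜 {u | ∃ s' ∈ A, Signature.Lt s' s ∧ u = f s'}) :
    Relation.ReflTransGen RowOp (ofFun A f) (ofFun A g) := by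
  classical
  -- The rows are replaced from the largest signature downwards: `U`, the set of signatures already
  -- treated, is closed upwards, so the rows below the next signature are still the original ones.
  suffices H : ∀ U : Finset (Signature n), U ⊆ A →
      (∀ s ∈ U, ∀ s' ∈ A, Signature.Lt s s' → s' ∈ U) → Relation.ReflTransGen RowOp (ofFun A f)
        (ofFun A fun s => if s ∈ U then g s else f s) by
    have := H A subset_rfl fun _ _ s' hs' _ => hs'
    rwa [ofFun_congr (g := g) fun s hs => if_pos hs] at this
  intro U
  induction U using Finset.induction_on_min_value Signature.key with
  | empty =>
    intro _ _
    simp only [Finset.notMem_empty, if_false]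
    exact Relation.ReflTransGen.refl
  | insert a U ha hmin ih =>
    intro hUA hU
    have haA := hUA (Finset.mem_insert_self a U)
    refine (ih ((Finset.subset_insert a U).trans hUA) fun s hs s' hs' hlt => ?_).trans ?_
    · rcases Finset.mem_insert.1 (hU s (Finset.mem_insert_of_mem hs) s' hs' hlt) with rfl | h'
      · exact absurd (hmin s hs) (not_le.2 (Signature.lt_iff_key.1 hlt))
      · exact h'
    · have hv : g a - f a ∈ Submodule.span 𝕜 {u | ∃ s' ∈ A, Signature.Lt s' a ∧
          u = (fun s => if s ∈ U then g s else f s) s'} := by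
        refine Submodule.span_mono ?_ (h a haA)
        rintro u ⟨s', hs', hlt, rfl⟩
        refine ⟨s', hs', hlt, (if_neg fun hs'U => ?_).symm⟩
        exact absurd (hmin s' hs'U) (not_le.2 (Signature.lt_iff_key.1 hlt))
      refine (reflTransGen_update haA hv).trans ?_
      rw [ofFun_congr]
      intro s _
      by_cases hsa : s = a
      · subst hsa
        simp [ha]
      · simp [hsa]

theorem reflTransGen_of_sub_mem_spanLt {M N : SigMatrix n 𝕜} (hM : M.DistinctSignatures)
    (hN : N.DistinctSignatures) (hMN : ∀ s, N.HasSignature s ↔ M.HasSignature s)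
    (h : ∀ s f f', (s, f) ∈ M → (s, f') ∈ N → f' - f ∈ M.spanLt s) :
    Relation.ReflTransGen RowOp M N := by
  obtain ⟨A, f, rfl⟩ := hM.exists_eq_ofFun
  obtain ⟨B, g, rfl⟩ := hN.exists_eq_ofFun
  have hAB : B = A := by
    ext s
    have := hMN s
    simpa [HasSignature, mem_ofFun] using this
  subst hAB
  refine reflTransGen_ofFun fun s hs => Submodule.span_mono ?_
    (h s (f s) (g s) (mem_ofFun.2 ⟨hs, rfl⟩) (mem_ofFun.2 ⟨hs, rfl⟩))
  rintro u ⟨s', hlt, hu⟩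
  exact ⟨s', (mem_ofFun.1 hu).1, hlt, (mem_ofFun.1 hu).2⟩

/-! ### Echelon forms -/

/-- A polynomial can be reduced modulo a set of rows until it vanishes or has a new leading
monomial. -/
theorem exists_reduced (M : SigMatrix n 𝕜) (f : MvPolynomial (Fin n) 𝕜) :
    ∃ f', f' - f ∈ Submodule.span 𝕜 M.rows ∧
      (f' ≠ 0 → ∀ u ∈ M.rows, u ≠ 0 → (grevlex n).degree u ≠ (grevlex n).degree f') := by
  by_cases h0 : ∃ f', f' - f ∈ Submodule.span 𝕜 M.rows ∧ f' = 0
  · obtain ⟨f', h, h'⟩ := h0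
    exact ⟨f', h, fun h'' => absurd h' h''⟩
  have wf : WellFounded fun u v : MvPolynomial (Fin n) 𝕜 =>
      (grevlex n).degree u ≺[grevlex n] (grevlex n).degree v :=
    InvImage.wf (fun u => (grevlex n).toSyn ((grevlex n).degree u)) wellFounded_lt
  obtain ⟨f', hf', hmin⟩ := wf.has_min {f' | f' - f ∈ Submodule.span 𝕜 M.rows} ⟨f, by simp⟩
  refine ⟨f', hf', fun _ u hu hu0 heq => ?_⟩
  obtain ⟨c, hc⟩ := exists_sub_smul_degree_lt hu0 heq.symm
  have hmem : f' - c • u - f ∈ Submodule.span 𝕜 M.rows := by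
    have := Submodule.sub_mem _ hf' (Submodule.smul_mem _ c (Submodule.subset_span hu))
    convert this using 1
    ring
  rcases hc with hc | hc
  · exact h0 ⟨_, hmem, hc⟩
  · exact hmin _ hmem hc

/-- The rows are added in increasing order of signature. The new row has the largest signature, so
reducing it by all the others is valid and leaves them untouched. -/
theorem exists_isEchelonFormOf_ofFun (A : Finset (Signature n))
    (f : Signature n → MvPolynomial (Fin n) 𝕜) :
    ∃ N, IsEchelonFormOf N (ofFun A f) := by
  classical
  induction A using Finset.induction_on_max_value Signature.key with
  | empty =>
    refine ⟨_, Relation.ReflTransGen.refl, fun r hr => ?_⟩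
    simp [ofFun] at hr
  | insert a A ha hmax ih =>
    obtain ⟨N, hN, hech⟩ := ih
    have hlt : ∀ s ∈ A, Signature.Lt s a := fun s hs => by
      rw [Signature.lt_iff_key]
      refine lt_of_le_of_ne (hmax s hs) fun h => ha ?_
      rwa [← Signature.key_injective h]
    have hsig := hasSignature_iff_of_reflTransGen hN
    have hsigA : ∀ r ∈ N, r.1 ∈ A := fun r hr => by
      obtain ⟨u, hu⟩ := (hsig r.1).1 ⟨r.2, hr⟩
      exact (mem_ofFun.1 hu).1
    have hdist := distinctSignatures_of_reflTransGen hN (distinctSignatures_ofFun A f)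
    obtain ⟨u, hu, hred⟩ := exists_reduced N (f a)
    have hsub : ofFun A f ⊆ ofFun (insert a A) f :=
      Finset.image_subset_image (Finset.subset_insert a A)
    have hrows : Submodule.span 𝕜 N.rows ≤ (ofFun (insert a A) f).spanLt a := by
      refine Submodule.span_le.2 ?_
      rintro v ⟨s, hs⟩
      obtain ⟨v', hv', hsub'⟩ := exists_sub_mem_spanLt hN _ hs
      have h1 := spanLt_mono hsub (Or.inr (hlt _ (hsigA _ hs))) hsub'
      have h2 : v' ∈ (ofFun (insert a A) f).spanLt a :=
        Submodule.subset_span ⟨s, hlt _ (hsigA _ hs), hsub hv'⟩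
      have := Submodule.add_mem _ h1 h2
      simpa using this
    refine ⟨insert (a, u) N, reflTransGen_of_sub_mem_spanLt (distinctSignatures_ofFun _ _) ?_ ?_ ?_,
      ?_⟩
    · intro r hr r' hr' heq
      rcases Finset.mem_insert.1 hr with rfl | hr <;> rcases Finset.mem_insert.1 hr' with rfl | hr'
      · rfl
      · exact absurd (show a ∈ A from (show a = r'.1 from heq) ▸ hsigA _ hr') ha
      · exact absurd (show a ∈ A from (show r.1 = a from heq) ▸ hsigA _ hr) ha
      · exact hdist _ hr _ hr' heq
    · intro s
      have h1 : (ofFun (insert a A) f).HasSignature s ↔ s = a ∨ (ofFun A f).HasSignature s := by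
        simp [HasSignature, mem_ofFun]
      rw [h1, ← hsig s]
      simp only [HasSignature, Finset.mem_insert, Prod.mk.injEq]
      constructor
      · rintro ⟨v, ⟨h, -⟩ | h⟩
        · exact Or.inl h
        · exact Or.inr ⟨v, h⟩
      · rintro (h | ⟨v, h⟩)
        · exact ⟨u, Or.inl ⟨h, rfl⟩⟩
        · exact ⟨v, Or.inr h⟩
    · intro s v v' hv hv'
      obtain rfl : v = f s := (mem_ofFun.1 hv).2
      rcases Finset.mem_insert.1 hv' with h | h
      · obtain ⟨rfl, rfl⟩ := Prod.mk.injEq _ _ _ _ ▸ h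
        exact hrows hu
      · obtain ⟨w, hw, hw'⟩ := exists_sub_mem_spanLt hN _ h
        obtain rfl : w = f s := (mem_ofFun.1 hw).2
        exact spanLt_mono hsub (Or.inl rfl) hw'
    · intro r hr r' hr' h0 h0' heq
      rcases Finset.mem_insert.1 hr with rfl | hr <;> rcases Finset.mem_insert.1 hr' with rfl | hr'
      · rfl
      · exact absurd heq.symm (hred h0 _ ⟨_, hr'⟩ h0')
      · exact absurd heq (hred h0' _ ⟨_, hr⟩ h0)
      · exact hech _ hr _ hr' h0 h0' heq

theorem exists_isEchelonization :
    ∃ ech : SigMatrix n 𝕜 → SigMatrix n 𝕜, IsEchelonization ech := by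
  have h : ∀ M : SigMatrix n 𝕜, ∃ N, M.DistinctSignatures → IsEchelonFormOf N M := by
    intro M
    by_cases hM : M.DistinctSignatures
    · obtain ⟨A, f, rfl⟩ := hM.exists_eq_ofFun
      obtain ⟨N, hN⟩ := exists_isEchelonFormOf_ofFun A f
      exact ⟨N, fun _ => hN⟩
    · exact ⟨M, fun h => absurd h hM⟩
  choose ech hech using h
  exact ⟨ech, hech⟩

/-- The leading monomial of a combination of the rows of an echelon form is the leading monomial of
a row. -/
theorem IsEchelon.exists_degree_eq {M : SigMatrix n 𝕜} (hM : M.IsEchelon)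
    {f : MvPolynomial (Fin n) 𝕜} (hf : f ∈ Submodule.span 𝕜 M.rows) (h0 : f ≠ 0) :
    ∃ r ∈ M, r.2 ≠ 0 ∧ (grevlex n).degree r.2 = (grevlex n).degree f := by
  classical
  -- Induction on the rows in increasing order of leading monomials: if the last row occurs with a
  -- nonzero contribution, no other row can cancel its leading term.
  suffices H : ∀ A : Finset (Signature n × MvPolynomial (Fin n) 𝕜), A ⊆ M →
      ∀ f ∈ Submodule.span 𝕜 (Prod.snd '' (A : Set (Signature n × MvPolynomial (Fin n) 𝕜))),
        f ≠ 0 → ∃ r ∈ A, r.2 ≠ 0 ∧ (grevlex n).degree r.2 = (grevlex n).degree f by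
    refine H M subset_rfl f ?_ h0
    convert hf using 2
    ext u
    simp [rows]
  intro A
  induction A using Finset.induction_on_max_value
    (fun r : Signature n × MvPolynomial (Fin n) 𝕜 =>
      (grevlex n).toSyn ((grevlex n).degree r.2)) with
  | empty =>
    intro _ f hf h0
    simp at hf
    exact absurd hf h0
  | insert r A hr hmax ih =>
    intro hA f hf h0
    have ih' := ih ((Finset.subset_insert r A).trans hA)
    rw [Finset.coe_insert, Set.image_insert_eq, Submodule.mem_span_insert] at hf
    obtain ⟨c, f', hf', rfl⟩ := hf
    by_cases hc : c • r.2 = 0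
    · rw [hc, zero_add] at h0 ⊢
      obtain ⟨q, hq, h⟩ := ih' f' hf' h0
      exact ⟨q, Finset.mem_insert_of_mem hq, h⟩
    have hc0 : c ≠ 0 := fun h => hc (by rw [h, zero_smul])
    have hr0 : r.2 ≠ 0 := fun h => hc (by rw [h, smul_zero])
    refine ⟨r, Finset.mem_insert_self r A, hr0, ?_⟩
    by_cases hf0 : f' = 0
    · rw [hf0, add_zero, grevlex_degree_smul hc0]
    obtain ⟨q, hq, hq0, hdeg⟩ := ih' f' hf' hf0
    rw [MonomialOrder.degree_add_of_lt, grevlex_degree_smul hc0]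
    rw [grevlex_degree_smul hc0]
    have hle := hmax q hq
    rw [hdeg] at hle
    refine lt_of_le_of_ne hle fun heq => ?_
    have := hM q (hA (Finset.mem_insert_of_mem hq)) r (hA (Finset.mem_insert_self r A)) hq0 hr0
      (hdeg.trans ((grevlex n).toSyn.injective heq))
    exact hr (this ▸ hq)

end SigMatrix

/-! ### Rows of Macaulay matrices modulo rows of smaller signature -/

section MacaulayRow

variable {n : ℕ} {𝕜 : Type*} [Field 𝕜] {t : ℕ}

/-- A finite sequence, continued by zeros. -/
noncomputable def seqTerm (F : Fin t → MvPolynomial (Fin n) 𝕜) (i : ℕ) : MvPolynomial (Fin n) 𝕜 :=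
  if h : i < t then F ⟨i, h⟩ else 0

theorem seqTerm_of_lt (F : Fin t → MvPolynomial (Fin n) 𝕜) {i : ℕ} (h : i < t) :
    seqTerm F i = F ⟨i, h⟩ := dif_pos h

theorem seqTerm_val (F : Fin t → MvPolynomial (Fin n) 𝕜) (i : Fin t) : seqTerm F i = F i :=
  dif_pos i.2

theorem seqTerm_isHomogeneous {F : Fin t → MvPolynomial (Fin n) 𝕜}
    (hF : ∀ i, ∃ d, (F i).IsHomogeneous d) (i : ℕ) :
    (seqTerm F i).IsHomogeneous (seqTerm F i).totalDegree := by
  by_cases h0 : seqTerm F i = 0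
  · rw [h0]
    exact isHomogeneous_zero _ _ _
  by_cases h : i < t
  · obtain ⟨d, hd⟩ := hF ⟨i, h⟩
    rw [← seqTerm_of_lt F h] at hd
    rwa [hd.totalDegree h0]
  · exact absurd (dif_neg h) h0

/-- The row with signature `s` of the Macaulay matrix of `F`. -/
noncomputable def macaulayRow (F : Fin t → MvPolynomial (Fin n) 𝕜) (s : Signature n) :
    MvPolynomial (Fin n) 𝕜 :=
  monomial s.2 1 * seqTerm F s.1

/-- The span of the rows of Macaulay matrices of `F`, in all degrees, of signature less than `s`. -/
noncomputable def lowerSpan (F : Fin t → MvPolynomial (Fin n) 𝕜) (s : Signature n) :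
    Submodule 𝕜 (MvPolynomial (Fin n) 𝕜) :=
  Submodule.span 𝕜 {u | ∃ s', Signature.Lt s' s ∧ u = macaulayRow F s'}

/-- The ideal generated by the first `i` terms of `F`. -/
noncomputable def initialIdeal (F : Fin t → MvPolynomial (Fin n) 𝕜) (i : ℕ) :
    Ideal (MvPolynomial (Fin n) 𝕜) :=
  Ideal.span {u | ∃ j < i, u = seqTerm F j}

variable (F : Fin t → MvPolynomial (Fin n) 𝕜)

theorem monomial_mul_macaulayRow (a b : Fin n →₀ ℕ) (i : ℕ) :
    monomial b 1 * macaulayRow F (i, a) = macaulayRow F (i, a + b) := by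
  rw [macaulayRow, macaulayRow, ← mul_assoc, monomial_mul, mul_one, add_comm]

theorem macaulayRow_isHomogeneous {F : Fin t → MvPolynomial (Fin n) 𝕜}
    (hF : ∀ i, ∃ d, (F i).IsHomogeneous d) (s : Signature n) :
    (macaulayRow F s).IsHomogeneous (s.2.degree + (seqTerm F s.1).totalDegree) :=
  (isHomogeneous_monomial 1 rfl).mul (seqTerm_isHomogeneous hF s.1)

variable {F}

theorem macaulayRow_mem_lowerSpan {s s' : Signature n} (h : Signature.Lt s' s) :
    macaulayRow F s' ∈ lowerSpan F s :=
  Submodule.subset_span ⟨s', h, rfl⟩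

theorem lowerSpan_mono {s s' : Signature n} (h : Signature.Lt s s') :
    lowerSpan F s ≤ lowerSpan F s' := by
  refine Submodule.span_mono ?_
  rintro u ⟨s'', hlt, rfl⟩
  exact ⟨s'', hlt.trans h, rfl⟩

/-- Redundancy passes to multiples, which is what allows the algorithm to work degree by degree. -/
theorem monomial_mul_mem_lowerSpan {i : ℕ} {a : Fin n →₀ ℕ} {f : MvPolynomial (Fin n) 𝕜}
    (hf : f ∈ lowerSpan F (i, a)) (b : Fin n →₀ ℕ) :
    monomial b 1 * f ∈ lowerSpan F (i, a + b) := by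
  induction hf using Submodule.span_induction with
  | mem x hx =>
    obtain ⟨⟨j, c⟩, hlt, rfl⟩ := hx
    rw [monomial_mul_macaulayRow]
    exact macaulayRow_mem_lowerSpan (hlt.add b)
  | zero => simp
  | add x y _ _ hx hy =>
    rw [mul_add]
    exact Submodule.add_mem _ hx hy
  | smul c x _ hx =>
    rw [mul_smul_comm]
    exact Submodule.smul_mem _ c hx

theorem mul_seqTerm_eq_sum (h : MvPolynomial (Fin n) 𝕜) (i : ℕ) :
    h * seqTerm F i = ∑ b ∈ h.support, h.coeff b • macaulayRow F (i, b) := by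
  conv_lhs => rw [← h.support_sum_monomial_coeff]
  rw [Finset.sum_mul]
  refine Finset.sum_congr rfl fun b _ => ?_
  rw [macaulayRow, ← smul_mul_assoc, smul_monomial, smul_eq_mul, mul_one]

/-- The exponent `a` is arbitrary because position is compared before term. -/
theorem mem_lowerSpan_of_mem_initialIdeal {i : ℕ} {f : MvPolynomial (Fin n) 𝕜}
    (hf : f ∈ initialIdeal F i) (a : Fin n →₀ ℕ) : f ∈ lowerSpan F (i, a) := by
  suffices H : ∀ q : MvPolynomial (Fin n) 𝕜, q * f ∈ lowerSpan F (i, a) by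
    simpa using H 1
  induction hf using Submodule.span_induction with
  | mem x hx =>
    obtain ⟨j, hj, rfl⟩ := hx
    intro q
    rw [mul_seqTerm_eq_sum]
    exact Submodule.sum_mem _ fun b _ =>
      Submodule.smul_mem _ _ (macaulayRow_mem_lowerSpan (Or.inl hj))
  | zero => simp
  | add x y _ _ hx hy =>
    intro q
    rw [mul_add]
    exact Submodule.add_mem _ (hx q) (hy q)
  | smul c x _ hx =>
    intro q
    rw [smul_eq_mul, ← mul_assoc]
    exact hx (q * c)

theorem macaulayRow_mem_initialIdeal {i : ℕ} {s : Signature n} (h : s.1 < i) :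
    macaulayRow F s ∈ initialIdeal F i :=
  Ideal.mul_mem_left _ _ (Ideal.subset_span ⟨s.1, h, rfl⟩)

theorem mem_initialIdeal_of_mem_lowerSpan {i : ℕ} {s : Signature n} (h : s.1 < i)
    {f : MvPolynomial (Fin n) 𝕜} (hf : f ∈ lowerSpan F s) : f ∈ initialIdeal F i := by
  have : lowerSpan F s ≤ (initialIdeal F i).restrictScalars 𝕜 := by
    refine Submodule.span_le.2 ?_
    rintro u ⟨s', hlt, rfl⟩
    refine macaulayRow_mem_initialIdeal ?_
    rcases hlt with hlt | ⟨hlt, -⟩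
    · exact hlt.trans h
    · exact hlt ▸ h
  exact this hf

/-- The leading monomial of a syzygy is a signature whose row in the Macaulay matrix is a
combination of the rows of smaller signature. -/
theorem macaulayRow_mem_lowerSpan_of_syzygy {i : ℕ} {h : MvPolynomial (Fin n) 𝕜} (h0 : h ≠ 0)
    (hs : h * seqTerm F i ∈ initialIdeal F i) :
    macaulayRow F (i, (grevlex n).degree h) ∈ lowerSpan F (i, (grevlex n).degree h) := by
  classical
  have h1 := mem_lowerSpan_of_mem_initialIdeal hs ((grevlex n).degree h)
  rw [mul_seqTerm_eq_sum, ← Finset.add_sum_erase _ _ ((grevlex n).degree_mem_support h0)] at h1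
  have h2 : ∑ b ∈ h.support.erase ((grevlex n).degree h), h.coeff b • macaulayRow F (i, b) ∈
      lowerSpan F (i, (grevlex n).degree h) := by
    refine Submodule.sum_mem _ fun b hb => Submodule.smul_mem _ _ (macaulayRow_mem_lowerSpan ?_)
    rw [Finset.mem_erase] at hb
    refine Or.inr ⟨rfl, lt_of_le_of_ne ((grevlex n).le_degree hb.2) fun heq => ?_⟩
    exact hb.1 ((grevlex n).toSyn.injective heq)
  exact ((lowerSpan F _).smul_mem_iff ((grevlex n).coeff_degree_ne_zero_iff.2 h0)).1
    ((Submodule.add_mem_iff_left _ h2).1 h1)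

end MacaulayRow

/-! ### Invariants of the matrix-F5 algorithm -/

section Invariants

variable {n : ℕ} {𝕜 : Type*} [Field 𝕜] {t : ℕ}

/-- The matrix `M` arises from the Macaulay matrix in degree `d` of the first `k` terms of `F` by
row operations, up to the removal of rows that are combinations of rows of smaller signature. -/
structure IsReducedMacaulay (F : Fin t → MvPolynomial (Fin n) 𝕜) (d k : ℕ) (M : SigMatrix n 𝕜) :
    Prop where
  distinct : M.DistinctSignatures
  index_lt : ∀ r ∈ M, r.1.1 < k
  degree_eq : ∀ r ∈ M, r.1.2.degree + (seqTerm F r.1.1).totalDegree = d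
  homogeneous : ∀ r ∈ M, r.2.IsHomogeneous d
  sub_mem : ∀ r ∈ M, r.2 - macaulayRow F r.1 ∈ lowerSpan F r.1
  complete : ∀ s : Signature n, s.1 < k → s.2.degree + (seqTerm F s.1).totalDegree = d →
    ¬ M.HasSignature s → macaulayRow F s ∈ lowerSpan F s

namespace IsReducedMacaulay

variable {F : Fin t → MvPolynomial (Fin n) 𝕜} {d k : ℕ} {M N : SigMatrix n 𝕜}

theorem of_reflTransGen (hM : IsReducedMacaulay F d k M)
    (h : Relation.ReflTransGen SigMatrix.RowOp M N) : IsReducedMacaulay F d k N where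
  distinct := SigMatrix.distinctSignatures_of_reflTransGen h hM.distinct
  index_lt := SigMatrix.forall_mem_of_reflTransGen h (P := fun s _ => s.1 < k)
    (fun _ _ _ _ _ _ hs _ => hs) hM.index_lt
  degree_eq := SigMatrix.forall_mem_of_reflTransGen h
    (P := fun s _ => s.2.degree + (seqTerm F s.1).totalDegree = d)
    (fun _ _ _ _ _ _ hs _ => hs) hM.degree_eq
  homogeneous := SigMatrix.forall_mem_of_reflTransGen h (P := fun _ f => f.IsHomogeneous d)
    (fun _ _ _ _ c _ hf hf' => hf.add (by simpa using (isHomogeneous_C _ c).mul hf'))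
    hM.homogeneous
  sub_mem := by
    refine SigMatrix.forall_mem_of_reflTransGen h
      (P := fun s f => f - macaulayRow F s ∈ lowerSpan F s) ?_ hM.sub_mem
    intro s s' f f' c hlt hf hf'
    have h1 : f' ∈ lowerSpan F s := by
      have := Submodule.add_mem _ (lowerSpan_mono hlt hf') (macaulayRow_mem_lowerSpan hlt)
      simpa using this
    have := Submodule.add_mem _ hf (Submodule.smul_mem _ c h1)
    rw [smul_eq_C_mul] at this
    convert this using 1
    ring
  complete := fun s hs hd hsM => hM.complete s hs hd fun h' =>
    hsM ((SigMatrix.hasSignature_iff_of_reflTransGen h s).2 h')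

theorem ech (hM : IsReducedMacaulay F d k M) {ech : SigMatrix n 𝕜 → SigMatrix n 𝕜}
    (hech : IsEchelonization ech) : IsReducedMacaulay F d k (ech M) :=
  hM.of_reflTransGen (hech M hM.distinct).1

theorem mem_initialIdeal (hM : IsReducedMacaulay F d k M) {f : MvPolynomial (Fin n) 𝕜}
    (hf : f ∈ M.rows) : f ∈ initialIdeal F k := by
  obtain ⟨s, hs⟩ := hf
  have h1 := hM.index_lt _ hs
  have := Ideal.add_mem _ (mem_initialIdeal_of_mem_lowerSpan h1 (hM.sub_mem _ hs))
    (macaulayRow_mem_initialIdeal h1)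
  simpa using this

theorem empty : IsReducedMacaulay F d 0 ∅ := by
  constructor <;> simp [SigMatrix.DistinctSignatures]

theorem succ_of_lt (hM : IsReducedMacaulay F d k M) (h : d < (seqTerm F k).totalDegree) :
    IsReducedMacaulay F d (k + 1) M where
  distinct := hM.distinct
  index_lt := fun r hr => (hM.index_lt r hr).trans (Nat.lt_succ_self k)
  degree_eq := hM.degree_eq
  homogeneous := hM.homogeneous
  sub_mem := hM.sub_mem
  complete := fun s hs hd => by
    refine hM.complete s (lt_of_le_of_ne (Nat.lt_succ_iff.1 hs) fun heq => ?_) hd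
    rw [heq] at hd
    omega

open Classical in
/-- To extend a matrix by one more term of the sequence one has to provide rows for this term. -/
theorem union (hM : IsReducedMacaulay F d k M) {K : SigMatrix n 𝕜}
    (hdist : K.DistinctSignatures) (hindex : ∀ r ∈ K, r.1.1 = k)
    (hdeg : ∀ r ∈ K, r.1.2.degree + (seqTerm F k).totalDegree = d)
    (hhom : ∀ r ∈ K, r.2.IsHomogeneous d)
    (hsub : ∀ r ∈ K, r.2 - macaulayRow F r.1 ∈ lowerSpan F r.1)
    (hcompl : ∀ a : Fin n →₀ ℕ, a.degree + (seqTerm F k).totalDegree = d →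
      ¬ K.HasSignature (k, a) → macaulayRow F (k, a) ∈ lowerSpan F (k, a)) :
    IsReducedMacaulay F d (k + 1) (M ∪ K) where
  distinct := by
    intro r hr r' hr' heq
    rcases Finset.mem_union.1 hr with hr | hr <;> rcases Finset.mem_union.1 hr' with hr' | hr'
    · exact hM.distinct r hr r' hr' heq
    · have := hM.index_lt r hr
      rw [heq, hindex r' hr'] at this
      exact absurd this (lt_irrefl k)
    · have := hM.index_lt r' hr'
      rw [← heq, hindex r hr] at this
      exact absurd this (lt_irrefl k)
    · exact hdist r hr r' hr' heq
  index_lt := by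
    intro r hr
    rcases Finset.mem_union.1 hr with hr | hr
    · exact (hM.index_lt r hr).trans (Nat.lt_succ_self k)
    · rw [hindex r hr]
      exact Nat.lt_succ_self k
  degree_eq := by
    intro r hr
    rcases Finset.mem_union.1 hr with hr | hr
    · exact hM.degree_eq r hr
    · rw [hindex r hr]
      exact hdeg r hr
  homogeneous := fun r hr => (Finset.mem_union.1 hr).elim (hM.homogeneous r) (hhom r)
  sub_mem := fun r hr => (Finset.mem_union.1 hr).elim (hM.sub_mem r) (hsub r)
  complete := by
    rintro ⟨i, a⟩ hs hd hnot
    rcases (Nat.lt_succ_iff.1 hs).lt_or_eq with h | h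
    · exact hM.complete _ h hd fun ⟨f, hf⟩ => hnot ⟨f, Finset.mem_union_left _ hf⟩
    · obtain rfl : i = k := h
      exact hcompl a hd fun ⟨f, hf⟩ => hnot ⟨f, Finset.mem_union_right _ hf⟩

open Classical in
theorem succ_of_eq (hF : ∀ i, ∃ d, (F i).IsHomogeneous d) (hM : IsReducedMacaulay F d k M)
    (h : d = (seqTerm F k).totalDegree) :
    IsReducedMacaulay F d (k + 1) (M ∪ {((k, 0), seqTerm F k)}) := by
  subst h
  refine hM.union ?_ ?_ ?_ ?_ ?_ ?_
  · intro r hr r' hr' _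
    rw [Finset.mem_singleton.1 hr, Finset.mem_singleton.1 hr']
  · intro r hr
    rw [Finset.mem_singleton.1 hr]
  · intro r hr
    rw [Finset.mem_singleton.1 hr]
    simp
  · intro r hr
    rw [Finset.mem_singleton.1 hr]
    exact seqTerm_isHomogeneous hF k
  · intro r hr
    rw [Finset.mem_singleton.1 hr]
    simp [macaulayRow]
  · intro a ha hnot
    have ha0 : a = 0 := (Finsupp.degree_eq_zero_iff a).1 (by omega)
    exact absurd ⟨_, Finset.mem_singleton.2 (by rw [ha0])⟩ hnot

/-- The variable `j` is forced to be the last one of the product. So the condition on `j` in the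
algorithm makes each new signature arise from only one parent. -/
theorem _root_.Finsupp.add_single_eq_of_last {a a' : Fin n →₀ ℕ} {j j' : Fin n}
    (h : ∀ i ∈ a.support, i ≤ j) (h' : ∀ i ∈ a'.support, i ≤ j')
    (heq : a + Finsupp.single j 1 = a' + Finsupp.single j' 1) : a = a' ∧ j = j' := by
  have key : ∀ {a a' : Fin n →₀ ℕ} {j j' : Fin n}, (∀ i ∈ a.support, i ≤ j) →
      a + Finsupp.single j 1 = a' + Finsupp.single j' 1 → j' ≤ j := by
    intro a a' j j' h heq
    by_contra! hlt
    have := DFunLike.congr_fun heq j'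
    have h0 : a j' = 0 := by
      by_contra h0
      exact absurd (h j' (Finsupp.mem_support_iff.2 h0)) (not_le.2 hlt)
    simp [h0, hlt.ne] at this
  have hj : j = j' := le_antisymm (key h' heq.symm) (key h heq)
  subst hj
  exact ⟨add_right_cancel heq, rfl⟩

theorem _root_.Finsupp.exists_eq_add_single_last {a : Fin n →₀ ℕ} (ha : a ≠ 0) :
    ∃ b j, (∀ i ∈ b.support, i ≤ j) ∧ a = b + Finsupp.single j 1 := by
  have hne : a.support.Nonempty := Finsupp.support_nonempty_iff.2 ha
  have hmem := a.support.max'_mem hne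
  set j := a.support.max' hne
  refine ⟨a - Finsupp.single j 1, j, fun i hi => ?_, ?_⟩
  · exact a.support.le_max' i (Finsupp.support_tsub hi)
  · rw [tsub_add_cancel_of_le]
    rw [Finsupp.single_le_iff]
    exact Nat.one_le_iff_ne_zero.2 (Finsupp.mem_support_iff.1 hmem)

open Classical in
/-- The rows for the next term of the sequence are multiples of those in the degree before. -/
theorem succ_of_gt (hM : IsReducedMacaulay F d k M) {P : SigMatrix n 𝕜}
    (hP : IsReducedMacaulay F (d - 1) (k + 1) P) (h : (seqTerm F k).totalDegree < d)
    (crit : Set (Signature n))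
    (hcrit : ∀ a, (k, a) ∈ crit → macaulayRow F (k, a) ∈ lowerSpan F (k, a))
    {K : SigMatrix n 𝕜} (hmem : ∀ r, r ∈ K ↔ ∃ b f j, ((k, b), f) ∈ P ∧
      (∀ i ∈ b.support, i ≤ j) ∧ ((k, b + Finsupp.single j 1) : Signature n) ∉ crit ∧
      r = ((k, b + Finsupp.single j 1), X j * f)) :
    IsReducedMacaulay F d (k + 1) (M ∪ K) := by
  refine hM.union ?_ ?_ ?_ ?_ ?_ ?_
  · intro r hr r' hr' heq
    obtain ⟨b, f, j, hf, hj, -, rfl⟩ := (hmem r).1 hr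
    obtain ⟨b', f', j', hf', hj', -, rfl⟩ := (hmem r').1 hr'
    obtain ⟨rfl, rfl⟩ := Finsupp.add_single_eq_of_last hj hj' (Prod.mk.inj heq).2
    obtain rfl : f = f' := (Prod.mk.inj (hP.distinct _ hf _ hf' rfl)).2
    rfl
  · intro r hr
    obtain ⟨b, f, j, hf, hj, -, rfl⟩ := (hmem r).1 hr
    rfl
  · intro r hr
    obtain ⟨b, f, j, hf, hj, -, rfl⟩ := (hmem r).1 hr
    have := hP.degree_eq _ hf
    simp only [map_add, Finsupp.degree_single] at this ⊢
    omega
  · intro r hr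
    obtain ⟨b, f, j, hf, hj, -, rfl⟩ := (hmem r).1 hr
    have := (isHomogeneous_X 𝕜 j).mul (hP.homogeneous _ hf)
    rwa [Nat.add_sub_cancel' (by omega)] at this
  · intro r hr
    obtain ⟨b, f, j, hf, hj, -, rfl⟩ := (hmem r).1 hr
    have := monomial_mul_mem_lowerSpan (hP.sub_mem _ hf) (Finsupp.single j 1)
    rw [mul_sub, monomial_mul_macaulayRow] at this
    exact this
  · intro a ha hnot
    -- A signature is missing either by `crit`, or because its unique parent is missing in degree `d
    -- - 1`; in the second case the redundancy of the parent is inherited.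
    by_cases hc : ((k, a) : Signature n) ∈ crit
    · exact hcrit a hc
    have ha0 : a ≠ 0 := by
      rintro rfl
      simp at ha
      omega
    obtain ⟨b, j, hj, rfl⟩ := Finsupp.exists_eq_add_single_last ha0
    rw [← monomial_mul_macaulayRow]
    refine monomial_mul_mem_lowerSpan (hP.complete (k, b) (Nat.lt_succ_self k) ?_ ?_) _
    · simp only [map_add, Finsupp.degree_single] at ha ⊢
      omega
    · rintro ⟨f, hf⟩
      exact hnot ⟨_, (hmem _).2 ⟨b, f, j, hf, hj, hc, rfl⟩⟩

end IsReducedMacaulay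

/-- The elements of `S` are signatures of rows of the Macaulay matrices of `F` that are combinations
of rows of smaller signature. Leading monomials of syzygies have this property. -/
def IsSyzygySignatures (F : Fin t → MvPolynomial (Fin n) 𝕜) (S : Set (Signature n)) : Prop :=
  ∀ s ∈ S, macaulayRow F s ∈ lowerSpan F s

/-- Induction on the degree and then on `k`, following the recursion of the algorithm; the content
is the redundancy of the three kinds of elements of `Crit`. -/
theorem isReducedMacaulay_sigMatrix {ech : SigMatrix n 𝕜 → SigMatrix n 𝕜}
    (hech : IsEchelonization ech) {F : Fin t → MvPolynomial (Fin n) 𝕜}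
    (hF : ∀ i, ∃ d, (F i).IsHomogeneous d) {S : Set (Signature n)} (hS : IsSyzygySignatures F S)
    (d k : ℕ) (hk : k ≤ t) : IsReducedMacaulay F d k (sigMatrix ech F S d k) := by
  induction d using Nat.strong_induction_on generalizing k with
  | _ d ihd =>
  induction k with
  | zero =>
    rw [sigMatrix]
    exact IsReducedMacaulay.empty
  | succ i ihi =>
    have hi : i < t := hk
    have hM := ihi hi.le
    rw [sigMatrix, dif_pos hi]
    have hterm := seqTerm_of_lt F hi
    dsimp only
    split_ifs with hlt heq
    · rw [← hterm] at hlt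
      exact hM.succ_of_lt hlt
    · rw [← hterm] at heq ⊢
      exact (hM.ech hech).succ_of_eq hF heq
    · have hgt : (seqTerm F i).totalDegree < d := by
        rw [hterm]
        omega
      refine (hM.ech hech).succ_of_gt (ihd (d - 1) (by omega) (i + 1) hk) hgt
        (S ∪ {s | s.1 = i ∧ ∃ r ∈ (sigMatrix ech F S (d - (F ⟨i, hi⟩).totalDegree) i).rows,
            r ≠ 0 ∧ s.2 = (grevlex n).degree r} ∪
          {s | s.1 = i ∧ ∃ a j, ((i, a), 0) ∈ ech (sigMatrix ech F S (d - 1) (i + 1)) ∧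
            s.2 = a + Finsupp.single j 1}) ?_ fun r => ?_
      rotate_left
      · simp only [Finset.mem_image, Finset.mem_filter, Finset.mem_product, Finset.mem_univ,
          and_true]
        constructor
        · rintro ⟨⟨⟨⟨i', b⟩, f⟩, j⟩, ⟨⟨hb, hi'⟩, hj, hc⟩, rfl⟩
          obtain rfl : i' = i := hi'
          exact ⟨b, f, j, hb, hj, hc, rfl⟩
        · rintro ⟨b, f, j, hb, hj, hc, rfl⟩
          exact ⟨(((i, b), f), j), ⟨⟨hb, rfl⟩, hj, hc⟩, rfl⟩
      rw [← hterm]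
      rintro a ((ha | ⟨-, r, hr, hr0, ha⟩) | ⟨-, b, j, hb, ha⟩)
      · exact hS _ ha
      · obtain rfl : a = (grevlex n).degree r := ha
        -- A Koszul syzygy: `r` is in the ideal of the earlier terms, hence so is its product with
        -- the current term. If that term has degree `0`, then `r` comes from the same degree `d`,
        -- where only the inner induction applies.
        refine macaulayRow_mem_lowerSpan_of_syzygy hr0 (Ideal.mul_mem_right _ _ ?_)
        by_cases h0 : (seqTerm F i).totalDegree = 0
        · rw [h0, Nat.sub_zero] at hr
          exact hM.mem_initialIdeal hr
        · exact (ihd _ (by omega) i hi.le).mem_initialIdeal hr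
      · obtain rfl : a = b + Finsupp.single j 1 := ha
        -- For a zero row the invariant says that its Macaulay row, up to sign, is a combination of
        -- smaller ones.
        have := ((ihd (d - 1) (by omega) (i + 1) hk).ech hech).sub_mem _ hb
        rw [zero_sub, Submodule.neg_mem_iff] at this
        rw [← monomial_mul_macaulayRow]
        exact monomial_mul_mem_lowerSpan this _

end Invariants

/-! ### Correctness of the matrix-F5 algorithm -/

section Correctness

variable {n : ℕ} {𝕜 : Type*} [Field 𝕜] {t : ℕ}

theorem mem_macaulay {F : Fin t → MvPolynomial (Fin n) 𝕜} {d : ℕ}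
    {r : Signature n × MvPolynomial (Fin n) 𝕜} :
    r ∈ macaulay F d ↔ r.1.1 < t ∧ r.1.2.degree + (seqTerm F r.1.1).totalDegree = d ∧
      r.2 = macaulayRow F r.1 := by
  classical
  obtain ⟨⟨i, a⟩, f⟩ := r
  simp only [macaulay, Finset.mem_biUnion, Finset.mem_filter, Finset.mem_univ, true_and,
    Finset.mem_image, Finset.mem_finsuppAntidiag, Finset.subset_univ, and_true, Prod.mk.injEq]
  have hsum : ∀ b : Fin n →₀ ℕ, Finset.univ.sum b = b.degree := fun b =>
    (Finsupp.degree_eq_sum b).symm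
  simp only [hsum]
  constructor
  · rintro ⟨j, hj, b, hb, ⟨rfl, rfl⟩, rfl⟩
    refine ⟨j.2, ?_, ?_⟩
    · rw [seqTerm_val]
      omega
    · rw [macaulayRow, seqTerm_val]
  · rintro ⟨hi, hd, rfl⟩
    rw [seqTerm_of_lt F hi] at hd
    refine ⟨⟨i, hi⟩, by omega, a, by omega, ⟨rfl, rfl⟩, ?_⟩
    rw [macaulayRow, seqTerm_of_lt F hi]

theorem macaulay_distinctSignatures (F : Fin t → MvPolynomial (Fin n) 𝕜) (d : ℕ) :
    (macaulay F d).DistinctSignatures := by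
  intro r hr r' hr' h
  rw [mem_macaulay] at hr hr'
  exact Prod.ext h (by rw [hr.2.2, hr'.2.2, h])

/-- `lowerSpan` mixes all degrees; taking the component of degree `d` keeps exactly the rows of that
degree and kills the others. -/
theorem mem_spanLt_macaulay {F : Fin t → MvPolynomial (Fin n) 𝕜}
    (hF : ∀ i, ∃ d, (F i).IsHomogeneous d) {d : ℕ} {s : Signature n}
    {f : MvPolynomial (Fin n) 𝕜} (hf : f ∈ lowerSpan F s) (hd : f.IsHomogeneous d) :
    f ∈ (macaulay F d).spanLt s := by
  rw [← homogeneousComponent_eq_self hd]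
  clear hd
  induction hf using Submodule.span_induction with
  | mem x hx =>
    obtain ⟨s', hlt, rfl⟩ := hx
    by_cases ht : s'.1 < t
    · rw [homogeneousComponent_of_mem (macaulayRow_isHomogeneous hF s')]
      split_ifs with h
      · exact Submodule.subset_span ⟨s', hlt, mem_macaulay.2 ⟨ht, h.symm, rfl⟩⟩
      · exact Submodule.zero_mem _
    · rw [macaulayRow, seqTerm, dif_neg ht, mul_zero, map_zero]
      exact Submodule.zero_mem _
  | zero => simp
  | add x y _ _ hx hy =>
    rw [map_add]
    exact Submodule.add_mem _ hx hy
  | smul c x _ hx =>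
    rw [map_smul]
    exact Submodule.smul_mem _ c hx

namespace SigMatrix

theorem RowOp.span_rows_le {M N : SigMatrix n 𝕜} (h : RowOp M N) :
    Submodule.span 𝕜 M.rows ≤ Submodule.span 𝕜 N.rows := by
  classical
  obtain ⟨r, hr, r', hr', hlt, c, rfl⟩ := h
  refine Submodule.span_le.2 ?_
  rintro f ⟨s, hf⟩
  by_cases hfr : (s, f) = r
  · subst hfr
    have h1 : r'.2 ∈ rows (insert (s, f + C c * r'.2) (Finset.erase M (s, f))) :=
      ⟨r'.1, Finset.mem_insert_of_mem (Finset.mem_erase.2 ⟨fun h => hlt.ne (Prod.ext_iff.1 h).1, hr'⟩)⟩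
    have h2 : f + C c * r'.2 ∈ rows (insert (s, f + C c * r'.2) (Finset.erase M (s, f))) :=
      ⟨s, Finset.mem_insert_self _ _⟩
    have := Submodule.sub_mem _ (Submodule.subset_span h2)
      (Submodule.smul_mem _ c (Submodule.subset_span (R := 𝕜) h1))
    rw [smul_eq_C_mul, add_sub_cancel_right] at this
    exact this
  · exact Submodule.subset_span ⟨s, Finset.mem_insert_of_mem (Finset.mem_erase.2 ⟨hfr, hf⟩)⟩

theorem span_rows_le_of_reflTransGen {M N : SigMatrix n 𝕜}
    (h : Relation.ReflTransGen RowOp M N) :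
    Submodule.span 𝕜 M.rows ≤ Submodule.span 𝕜 N.rows := by
  induction h with
  | refl => exact le_rfl
  | tail _ h ih => exact ih.trans h.span_rows_le

end SigMatrix

/-- A reduced matrix in echelon form is a row echelon form of the Macaulay matrix, up to rows that
are zero. -/
theorem IsReducedMacaulay.exists_isEchelonFormOf {F : Fin t → MvPolynomial (Fin n) 𝕜}
    (hF : ∀ i, ∃ d, (F i).IsHomogeneous d) {d : ℕ} {N : SigMatrix n 𝕜}
    (hN : IsReducedMacaulay F d t N) (hech : N.IsEchelon) :
    ∃ T : SigMatrix n 𝕜, T.IsEchelonFormOf (macaulay F d) ∧ N ⊆ T ∧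
      ∀ r ∈ T, r.2 ≠ 0 → r ∈ N := by
  classical
  -- `Z` supplies a zero row for each missing signature. These are reachable by row operations since
  -- the missing rows are redundant.
  obtain ⟨Z, hmemZ⟩ : ∃ Z : SigMatrix n 𝕜, ∀ r, r ∈ Z ↔ (macaulay F d).HasSignature r.1 ∧
      ¬ N.HasSignature r.1 ∧ r.2 = 0 := by
    refine ⟨((macaulay F d).filter fun r => ¬ N.HasSignature r.1).image fun r => (r.1, 0), ?_⟩
    rintro ⟨s, f⟩
    simp only [Finset.mem_image, Finset.mem_filter, Prod.mk.injEq]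
    constructor
    · rintro ⟨q, ⟨hq, hqN⟩, rfl, rfl⟩
      exact ⟨⟨q.2, hq⟩, hqN, rfl⟩
    · rintro ⟨⟨u, hu⟩, hsN, rfl⟩
      exact ⟨(s, u), ⟨hu, hsN⟩, rfl, rfl⟩
  have hnonzero : ∀ r ∈ N ∪ Z, r.2 ≠ 0 → r ∈ N := by
    intro r hr h0
    rcases Finset.mem_union.1 hr with hr | hr
    · exact hr
    · exact absurd ((hmemZ r).1 hr).2.2 h0
  refine ⟨N ∪ Z, ⟨SigMatrix.reflTransGen_of_sub_mem_spanLt (macaulay_distinctSignatures F d)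
    ?_ ?_ ?_, ?_⟩, Finset.subset_union_left, hnonzero⟩
  · intro r hr r' hr' heq
    rcases Finset.mem_union.1 hr with hr | hr <;> rcases Finset.mem_union.1 hr' with hr' | hr'
    · exact hN.distinct r hr r' hr' heq
    · exact absurd ⟨r.2, by rw [← heq]; exact hr⟩ ((hmemZ r').1 hr').2.1
    · exact absurd ⟨r'.2, by rw [heq]; exact hr'⟩ ((hmemZ r).1 hr).2.1
    · exact Prod.ext heq (((hmemZ r).1 hr).2.2.trans ((hmemZ r').1 hr').2.2.symm)
  · intro s
    constructor
    · rintro ⟨f, hf⟩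
      rcases Finset.mem_union.1 hf with hf | hf
      · exact ⟨macaulayRow F s, mem_macaulay.2
          ⟨hN.index_lt (s, f) hf, hN.degree_eq (s, f) hf, rfl⟩⟩
      · exact ((hmemZ _).1 hf).1
    · intro h
      by_cases hs : N.HasSignature s
      · obtain ⟨f, hf⟩ := hs
        exact ⟨f, Finset.mem_union_left _ hf⟩
      · exact ⟨0, Finset.mem_union_right _ ((hmemZ (s, 0)).2 ⟨h, hs, rfl⟩)⟩
  · intro s f f' hf hf'
    obtain ⟨hs, hd, hf⟩ := mem_macaulay.1 hf
    obtain rfl : f = macaulayRow F s := hf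
    have hrow : (macaulayRow F s).IsHomogeneous d := hd ▸ macaulayRow_isHomogeneous hF s
    rcases Finset.mem_union.1 hf' with hf' | hf'
    · exact mem_spanLt_macaulay hF (hN.sub_mem (s, f') hf')
        ((hN.homogeneous (s, f') hf').sub hrow)
    · obtain ⟨-, hsN, h0⟩ := (hmemZ _).1 hf'
      obtain rfl : f' = 0 := h0
      rw [zero_sub, Submodule.neg_mem_iff]
      exact mem_spanLt_macaulay hF (hN.complete s hs hd hsN) hrow
  · intro r hr r' hr' h0 h0' heq
    exact hech r (hnonzero r hr h0) r' (hnonzero r' hr' h0') h0 h0' heq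

theorem mem_span_leadingMonomials_iff {G : Set (MvPolynomial (Fin n) 𝕜)}
    {f : MvPolynomial (Fin n) 𝕜} :
    f ∈ Ideal.span (leadingMonomials G) ↔
      ∀ a ∈ f.support, ∃ g ∈ G, g ≠ 0 ∧ (grevlex n).degree g ≤ a := by
  have : leadingMonomials G =
      (fun s => monomial s (1 : 𝕜)) '' {s | ∃ g ∈ G, g ≠ 0 ∧ s = (grevlex n).degree g} := by
    ext u
    constructor
    · rintro ⟨g, hg, h0, rfl⟩
      exact ⟨_, ⟨g, hg, h0, rfl⟩, rfl⟩
    · rintro ⟨_, ⟨g, hg, h0, rfl⟩, rfl⟩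
      exact ⟨g, hg, h0, rfl⟩
  rw [this, mem_ideal_span_monomial_image]
  refine forall₂_congr fun a _ => ?_
  constructor
  · rintro ⟨_, ⟨g, hg, h0, rfl⟩, h⟩
    exact ⟨g, hg, h0, h⟩
  · rintro ⟨g, hg, h0, h⟩
    exact ⟨_, ⟨g, hg, h0, rfl⟩, h⟩

section SigBasis

variable {ech : SigMatrix n 𝕜 → SigMatrix n 𝕜} {F : Fin t → MvPolynomial (Fin n) 𝕜}
  {S : Set (Signature n)} {k : ℕ}

theorem exists_mem_rows_of_mem_sigBasis {m : ℕ} {f : MvPolynomial (Fin n) 𝕜}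
    (hf : f ∈ sigBasis ech F S k m) : ∃ d < m, f ∈ (ech (sigMatrix ech F S d k)).rows := by
  classical
  induction m with
  | zero => simp [sigBasis] at hf
  | succ m ih =>
    rw [sigBasis] at hf
    rcases Finset.mem_union.1 hf with hf | hf
    · obtain ⟨d, hd, h⟩ := ih hf
      exact ⟨d, hd.trans (Nat.lt_succ_self m), h⟩
    · obtain ⟨r, hr, rfl⟩ := Finset.mem_image.1 (Finset.mem_filter.1 hf).1
      exact ⟨m, Nat.lt_succ_self m, r.1, hr⟩

theorem exists_mem_sigBasis_degree_le {d m : ℕ} (hdm : d < m) {f : MvPolynomial (Fin n) 𝕜}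
    (hf : f ∈ (ech (sigMatrix ech F S d k)).rows) (h0 : f ≠ 0) :
    ∃ g ∈ sigBasis ech F S k m, g ≠ 0 ∧ (grevlex n).degree g ≤ (grevlex n).degree f := by
  classical
  induction m with
  | zero => omega
  | succ m ih =>
    rw [sigBasis]
    by_cases hd : d < m
    · obtain ⟨g, hg, h⟩ := ih hd
      exact ⟨g, Finset.mem_union_left _ hg, h⟩
    obtain rfl : d = m := by omega
    by_cases hmem : f ∈ Ideal.span
        (leadingMonomials (sigBasis ech F S k d : Set (MvPolynomial (Fin n) 𝕜)))
    -- The algorithm tests `f` itself rather than its leading monomial. This is harmless: when `f`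
    -- is discarded, all its monomials, in particular the leading one, are in the monomial ideal.
    · obtain ⟨g, hg, h⟩ := mem_span_leadingMonomials_iff.1 hmem _
        ((grevlex n).degree_mem_support h0)
      exact ⟨g, Finset.mem_union_left _ hg, h⟩
    · obtain ⟨s, hs⟩ := hf
      exact ⟨f, Finset.mem_union_right _ (Finset.mem_filter.2
        ⟨Finset.mem_image.2 ⟨_, hs, rfl⟩, hmem⟩), h0, le_rfl⟩

theorem mem_initialIdeal_of_mem_sigGB (hech : IsEchelonization ech)
    (hF : ∀ i, ∃ d, (F i).IsHomogeneous d) (hS : IsSyzygySignatures F S) (hk : k ≤ t) {D : ℤ}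
    {f : MvPolynomial (Fin n) 𝕜} (hf : f ∈ sigGB ech F S D k) : f ∈ initialIdeal F k := by
  obtain ⟨d, -, h⟩ := exists_mem_rows_of_mem_sigBasis hf
  exact ((isReducedMacaulay_sigMatrix hech hF hS d k hk).ech hech).mem_initialIdeal h

theorem isMacaulayBasis_sigGB (hech : IsEchelonization ech)
    (hF : ∀ i, ∃ d, (F i).IsHomogeneous d) (hS : IsSyzygySignatures F S) (D : ℕ) :
    IsMacaulayBasis F D (sigGB ech F S D t : Set (MvPolynomial (Fin n) 𝕜)) := by
  have hred := fun d => isReducedMacaulay_sigMatrix hech hF hS d t le_rfl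
  have hT := fun d => ((hred d).ech hech).exists_isEchelonFormOf hF (hech _ (hred d).distinct).2
  choose T hT hNT hTN using hT
  have hD : ((D : ℤ) + 1).toNat = D + 1 := by omega
  refine ⟨T, fun d _ => hT d, fun g hg => ?_, fun d hd f hf h0 => ?_⟩
  · obtain ⟨d, hd, s, h⟩ := exists_mem_rows_of_mem_sigBasis (Finset.mem_coe.1 hg)
    exact ⟨d, by omega, s, hNT d h⟩
  · obtain ⟨s, hs⟩ := hf
    exact exists_mem_sigBasis_degree_le (by omega) ⟨s, hTN d _ hs h0⟩ h0

end SigBasis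

theorem IsMacaulayBasis.isTruncatedGroebnerBasis {F : Fin t → MvPolynomial (Fin n) 𝕜}
    (hF : ∀ i, ∃ d, (F i).IsHomogeneous d) {D : ℕ} {G : Set (MvPolynomial (Fin n) 𝕜)}
    (hG : IsMacaulayBasis F D G) : IsTruncatedGroebnerBasis (initialIdeal F t) D G := by
  obtain ⟨T, hT, hGT, hTG⟩ := hG
  have hrow : ∀ d ≤ D, ∀ f ∈ (T d).rows, f ∈ initialIdeal F t ∧ f.IsHomogeneous d := by
    rintro d hd f ⟨s, hs⟩
    refine SigMatrix.forall_mem_of_reflTransGen (hT d hd).1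
      (P := fun _ f => f ∈ initialIdeal F t ∧ f.IsHomogeneous d) ?_ ?_ _ hs
    · rintro _ _ f f' c _ ⟨hf, hf'⟩ ⟨hg, hg'⟩
      exact ⟨Ideal.add_mem _ hf (Ideal.mul_mem_left _ _ hg),
        hf'.add (by simpa using (isHomogeneous_C _ c).mul hg')⟩
    · intro r hr
      obtain ⟨h1, h2, h3⟩ := mem_macaulay.1 hr
      rw [h3]
      exact ⟨macaulayRow_mem_initialIdeal h1, h2 ▸ macaulayRow_isHomogeneous hF _⟩
  have hGI : ∀ g ∈ G, g ∈ initialIdeal F t ∧ ∃ d ≤ D, g.IsHomogeneous d := fun g hg => by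
    obtain ⟨d, hd, h⟩ := hGT g hg
    exact ⟨(hrow d hd g h).1, d, hd, (hrow d hd g h).2⟩
  refine ⟨fun g hg => (hGI g hg).1, le_antisymm (Ideal.span_mono ?_) (Ideal.span_le.2 ?_)⟩
  · rintro u ⟨g, hg, h0, rfl⟩
    exact ⟨g, hGI g hg, h0, rfl⟩
  · rintro u ⟨f, ⟨hf, d, hd, hfd⟩, h0, rfl⟩
    -- The signature `(t, 0)` exceeds all those of the Macaulay matrix, so "smaller signature" is no
    -- restriction here.
    have h1 := mem_spanLt_macaulay hF (mem_lowerSpan_of_mem_initialIdeal hf 0) hfd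
    have h2 : f ∈ Submodule.span 𝕜 (T d).rows := by
      refine SigMatrix.span_rows_le_of_reflTransGen (hT d hd).1 (Submodule.span_mono ?_ h1)
      rintro v ⟨s, -, hs⟩
      exact ⟨s, hs⟩
    obtain ⟨r, hr, hr0, hdeg⟩ := (hT d hd).2.exists_degree_eq h2 h0
    obtain ⟨g, hg, hg0, hle⟩ := hTG d hd r.2 ⟨r.1, hr⟩ hr0
    refine mem_span_leadingMonomials_iff.2 fun a ha => ⟨g, hg, hg0, ?_⟩
    rw [Finset.mem_singleton.1 (support_monomial_subset ha), ← hdeg]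
    exact hle

end Correctness

/-! ### Critical points -/

section Critical

variable {n : ℕ} {𝕜 : Type*} [Field 𝕜] {p t : ℕ}

/-- An entry of a matrix in a column to the left of those of a maximal minor, times this minor, is
a combination of the maximal minors with smaller column indices. -/
theorem Matrix.mul_det_submatrix_mem_span {R : Type*} [CommRing R]
    (A : Matrix (Fin (p + 1)) (Fin n) R) (c : Fin (p + 1) ↪o Fin n) (i : Fin (p + 1)) (j : Fin n)
    (hj : ∀ l, j < c l) :
    A i j * (A.submatrix id c).det ∈ Ideal.span {h | ∃ c' : Fin (p + 1) ↪o Fin n,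
      toLex (c' : Fin (p + 1) → Fin n) < toLex (c : Fin (p + 1) → Fin n) ∧
        h = (A.submatrix id c').det} := by
  set cols : Fin (p + 2) → Fin n := Fin.cons j c with hcols
  have hmono : StrictMono cols := by
    refine Fin.strictMono_iff_lt_succ.2 fun l => ?_
    induction l using Fin.cases with
    | zero => simpa [hcols] using hj 0
    | succ l =>
      rw [← Fin.succ_castSucc, hcols, Fin.cons_succ, Fin.cons_succ]
      exact c.strictMono l.castSucc_lt_succ
  -- Row `i` is repeated on top and column `j` is put in front; expansion along the top row starts
  -- with the desired product.
  have hdet : (A.submatrix (Fin.cons i id : Fin (p + 2) → Fin (p + 1)) cols).det = 0 :=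
    Matrix.det_zero_of_row_eq (Fin.succ_ne_zero i).symm (by ext l; simp)
  rw [Matrix.det_succ_row_zero, Fin.sum_univ_succ] at hdet
  simp only [Matrix.submatrix_apply, Matrix.submatrix_submatrix, Fin.cons_zero, Fin.val_zero,
    pow_zero, one_mul] at hdet
  have h0 : (Fin.cons i id : Fin (p + 2) → Fin (p + 1)) ∘ Fin.succ = id := by
    ext l
    simp
  have h1 : cols ∘ Fin.succAbove 0 = c := by
    ext l
    simp [hcols]
  rw [h0, h1, hcols, Fin.cons_zero] at hdet
  rw [eq_neg_of_add_eq_zero_left hdet]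
  refine Ideal.neg_mem_iff _ |>.2 (Ideal.sum_mem _ fun l _ => Ideal.mul_mem_left _ _ ?_)
  -- The remaining minors keep `j` as their first column, and `j < c 0` decides the lexicographic
  -- comparison.
  refine Ideal.subset_span ⟨OrderEmbedding.ofStrictMono (cols ∘ Fin.succAbove l.succ)
    (hmono.comp (Fin.strictMono_succAbove _)), ⟨0, fun l' hl' => absurd hl' (Fin.not_lt_zero l'), ?_⟩,
    rfl⟩
  simpa [hcols] using hj 0

theorem isHomogeneous_jac (g : MvPolynomial (Fin n) 𝕜) {F : Fin p → MvPolynomial (Fin n) 𝕜}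
    (hF : ∀ i, ∃ d, (F i).IsHomogeneous d) (hg : ∃ d, g.IsHomogeneous d) :
    ∃ d : Fin (p + 1) → ℕ, ∀ i j, (jac g F i j).IsHomogeneous (d i) := by
  have h : ∀ i, ∃ d, ((Fin.cons g F : Fin (p + 1) → MvPolynomial (Fin n) 𝕜) i).IsHomogeneous d := by
    intro i
    induction i using Fin.cases with
    | zero => simpa using hg
    | succ i => simpa using hF i
  choose d hd using h
  exact ⟨fun i => d i - 1, fun i j => (hd i).pderiv⟩

/-- The degree of an entry depends only on its row, and each term of the Leibniz formula meets every
row once. -/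
theorem isHomogeneous_det {σ R : Type*} [CommRing R] {m : ℕ}
    (A : Matrix (Fin m) (Fin m) (MvPolynomial σ R)) (d : Fin m → ℕ)
    (hA : ∀ i j, (A i j).IsHomogeneous (d i)) : A.det.IsHomogeneous (∑ i, d i) := by
  rw [Matrix.det_apply]
  refine IsHomogeneous.sum _ _ _ fun τ _ => ?_
  have h : (∏ i, A (τ i) i).IsHomogeneous (∑ i, d i) := by
    rw [← Equiv.sum_comp τ d]
    exact IsHomogeneous.prod _ _ _ fun i _ => hA _ _
  rcases Int.units_eq_one_or (Equiv.Perm.sign τ) with hτ | hτ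
  · rwa [hτ, one_smul]
  · rw [hτ, Units.neg_smul, one_smul]
    exact h.neg

variable {F : Fin p → MvPolynomial (Fin n) 𝕜} {g : MvPolynomial (Fin n) 𝕜}

theorem isHomogeneous_critSystem (hF : ∀ i, ∃ d, (F i).IsHomogeneous d)
    (hg : ∃ d, g.IsHomogeneous d) (e : Fin t ≃ Fin p ⊕ (Fin (p + 1) ↪o Fin n)) (k : Fin t) :
    ∃ d, (critSystem F g e k).IsHomogeneous d := by
  rw [critSystem]
  rcases e k with i | c
  · exact hF i
  · obtain ⟨d, hd⟩ := isHomogeneous_jac g hF hg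
    exact ⟨_, isHomogeneous_det _ d fun i j => hd i (c j)⟩

theorem initialIdeal_critSystem (e : Fin t ≃ Fin p ⊕ (Fin (p + 1) ↪o Fin n)) :
    initialIdeal (critSystem F g e) t = criticalIdeal F g := by
  refine le_antisymm (Ideal.span_le.2 ?_) (sup_le (Ideal.span_le.2 ?_) (Ideal.span_le.2 ?_))
  · rintro u ⟨k, hk, rfl⟩
    rw [seqTerm_of_lt _ hk, critSystem]
    rcases e ⟨k, hk⟩ with i | c
    · exact Ideal.mem_sup_left (Ideal.subset_span ⟨i, rfl⟩)
    · exact Ideal.mem_sup_right (Ideal.subset_span ⟨RelEmbedding.refl _, c, rfl⟩)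
  · rintro u ⟨i, rfl⟩
    refine Ideal.subset_span ⟨e.symm (Sum.inl i), Fin.is_lt _, ?_⟩
    rw [seqTerm_val, critSystem, Equiv.apply_symm_apply, Sum.elim_inl]
  · rintro u ⟨r, c, rfl⟩
    refine Ideal.subset_span ⟨e.symm (Sum.inr c), Fin.is_lt _, ?_⟩
    rw [seqTerm_val, critSystem, Equiv.apply_symm_apply, Sum.elim_inr, jacMinor,
      -- A maximal minor uses all rows, so the order embedding `r` selecting them is the identity.
      (StrictMono.range_inj r.strictMono strictMono_id).1 ?_]
    rw [(Finite.injective_iff_surjective.1 r.injective).range_eq, Set.range_id]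

theorem mul_jacMinor_mem_initialIdeal (e : Fin t ≃ Fin p ⊕ (Fin (p + 1) ↪o Fin n))
    (he : ∀ c c' : Fin (p + 1) ↪o Fin n,
      toLex (c : Fin (p + 1) → Fin n) < toLex (c' : Fin (p + 1) → Fin n) →
        e.symm (Sum.inr c) < e.symm (Sum.inr c'))
    {i : ℕ} (hi : i ≤ (n - p - 1) * (p + 1)) {c : Fin (p + 1) ↪o Fin n}
    (hc : ∀ j, i ⌈/⌉ (p + 1) ≤ (c j : ℕ)) {h : MvPolynomial (Fin n) 𝕜}
    (hh : h ∈ initialIdeal (jacColumns g F) i) :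
    h * jacMinor g F c ∈ initialIdeal (critSystem F g e) (e.symm (Sum.inr c)) := by
  induction hh using Submodule.span_induction with
  | mem x hx =>
    obtain ⟨k, hk, rfl⟩ := hx
    rw [seqTerm_of_lt _ (hk.trans_le hi), jacColumns, jacMinor]
    refine Ideal.span_mono ?_ (Matrix.mul_det_submatrix_mem_span _ c _ _ fun l => ?_)
    · rintro u ⟨c', hc', rfl⟩
      refine ⟨e.symm (Sum.inr c'), he c' c hc', ?_⟩
      rw [seqTerm_val, critSystem, Equiv.apply_symm_apply, Sum.elim_inr, jacMinor]
    · have h1 := hc l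
      -- Counted from `0`, entry `k` lies in column `k / (p + 1)`, and `k < i` puts this strictly
      -- below `⌈i / (p + 1)⌉`, hence to the left of all columns of `c`.
      rw [Nat.ceilDiv_eq_add_pred_div] at h1
      have h2 : k / (p + 1) + 1 ≤ (i + (p + 1) - 1) / (p + 1) := by
        rw [← Nat.add_div_right k (Nat.succ_pos p)]
        exact Nat.div_le_div_right (by omega)
      rw [Fin.lt_def]
      simp only [Fin.val_castLE, Fin.coe_divNat]
      omega
  | zero => simp
  | add x y _ _ hx hy =>
    rw [add_mul]
    exact Ideal.add_mem _ hx hy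
  | smul a x _ hx =>
    rw [smul_eq_mul, mul_assoc]
    exact Ideal.mul_mem_left _ _ hx

/-- Only the membership of `G_i` in the ideal of the first `i` entries matters, not that `G_i` is a
Gröbner basis; so the degree bound of the first run affects how many rows are avoided but not
correctness. -/
theorem isSyzygySignatures_critSyzygies {ech : SigMatrix n 𝕜 → SigMatrix n 𝕜}
    (hech : IsEchelonization ech) (hF : ∀ i, ∃ d, (F i).IsHomogeneous d)
    (hg : ∃ d, g.IsHomogeneous d) (e : Fin t ≃ Fin p ⊕ (Fin (p + 1) ↪o Fin n))
    (he : ∀ c c' : Fin (p + 1) ↪o Fin n,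
      toLex (c : Fin (p + 1) → Fin n) < toLex (c' : Fin (p + 1) → Fin n) →
        e.symm (Sum.inr c) < e.symm (Sum.inr c')) (D : ℕ) :
    IsSyzygySignatures (critSystem F g e) (critSyzygies ech F g e D) := by
  rintro s ⟨i, hi, c, hc, h, hh, h0, rfl⟩
  have hi' := (Finset.mem_Icc.1 hi).2
  obtain ⟨d, hd⟩ := isHomogeneous_jac g hF hg
  have hmem := mem_initialIdeal_of_mem_sigGB hech (fun k => ⟨_, hd _ _⟩)
    (fun s hs => absurd hs (Set.notMem_empty s)) hi' hh
  refine macaulayRow_mem_lowerSpan_of_syzygy h0 ?_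
  have := mul_jacMinor_mem_initialIdeal e he hi' hc hmem
  rwa [seqTerm_val, critSystem, Equiv.apply_symm_apply, Sum.elim_inr]

end Critical

theorem mainTheorem3 {𝕜 : Type*} [Field 𝕜] {n p : ℕ}
    (F : Fin p → MvPolynomial (Fin n) 𝕜) (g : MvPolynomial (Fin n) 𝕜)
    (hF : ∀ i, ∃ d, (F i).IsHomogeneous d) (hg : ∃ d, g.IsHomogeneous d) (D : ℕ)
    {t : ℕ} (e : Fin t ≃ Fin p ⊕ (Fin (p + 1) ↪o Fin n))
    (he : ∀ c c' : Fin (p + 1) ↪o Fin n,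
      toLex (c : Fin (p + 1) → Fin n) < toLex (c' : Fin (p + 1) → Fin n) →
        e.symm (Sum.inr c) < e.symm (Sum.inr c')) :
    (∃ ech : SigMatrix n 𝕜 → SigMatrix n 𝕜, IsEchelonization ech) ∧
    ∀ ech : SigMatrix n 𝕜 → SigMatrix n 𝕜, IsEchelonization ech →
      IsMacaulayBasis (critSystem F g e) D (critGB ech F g e D) ∧
      IsTruncatedGroebnerBasis (criticalIdeal F g) D (critGB ech F g e D) := by
  refine ⟨SigMatrix.exists_isEchelonization, fun ech hech => ?_⟩
  have hhom := isHomogeneous_critSystem hF hg e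
  have hG : IsMacaulayBasis (critSystem F g e) D (critGB ech F g e D) :=
    isMacaulayBasis_sigGB hech hhom (isSyzygySignatures_critSyzygies hech hF hg e he D) D
  refine ⟨hG, ?_⟩
  rw [← initialIdeal_critSystem e]
  exact hG.isTruncatedGroebnerBasis hhom
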